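/- Let \(L\) and \(H\) be topological groupoids with open range and source maps \(r,s\), and let \(F\colon L\to H\) be a groupoid fibration, that is, a continuous functor for which \((F^1,s)\colon L^1\to H^1\times_{s,H^0,F^0}L^0\) is an open surjection. Let \(G\) be its fibre: the topological groupoid with \(G^0=L^0\) and \(G^1=\{g\in L^1 : F^1(g)=1_{F^0(s(g))}\}\). Assume that \(G\) and \(H\) are locally Hausdorff, locally compact groupoids with Hausdorff object spaces. For a locally Hausdorff, locally compact space \(X\), a function \(X\to\mathbb C\) is called quasi-continuous if it is a finite linear combination of compactly supported continuous functions on Hausdorff open subsets of \(X\), extended by \(0\). A continuous family of measures along the fibres of a map \(p\colon X\to Y\) consists of Radon measures \(\alpha^y\) on \(p^{-1}(y)\) for \(y\in Y\) such that \(y\mapsto\int f\,\mathrm d\alpha^y\) is quasi-continuous on \(Y\) for every quasi-continuous \(f\) on \(X\). A Haar system on a groupoid \(G\) is a continuous family of measures \((\lambda^x)_{x\in G^0}\) along the fibres \(G^x=r^{-1}(x)\) of \(r\colon G^1\to G^0\) such that \(\lambda^x\) has full support \(G^x\) for all \(x\), and left translation by \(k\), \(g\mapsto kg\), maps \(\lambda^{s(k)}\)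 to \(\lambda^{r(k)}\) for all \(k\in G^1\). Let \((\lambda^x)_{x\in G^0}\) and \((\mu^y)_{y\in H^0}\) be Haar systems on \(G\) and \(H\). Then \(L^1\) is locally Hausdorff and locally compact, and the following hold. (1) There is a continuous family of measures \(\dot\lambda\) along the fibres of \((F^1,r)\colon L^1\to H^1\times_{r,H^0,F^0}L^0\) such that \[ \int f(l)\,\mathrm d\dot\lambda^{(h,x)}(l)=\int_{G^{s(k)}} f(kg)\,\mathrm d\lambda^{s(k)}(g) \] for every \((h,x)\in H^1\times_{r,H^0,F^0}L^0\) and any \(k\in L^1\) with \(F^1(k)=h\) and \(r(k)=x\); that is, \(\dot\lambda^{(h,x)}\) is the image of \(\lambda^{s(k)}\) under the map \(g\mapsto kg\) from \(G^{s(k)}\) to \((F^1,r)^{-1}(h,x)\), for any such \(k\). (2) There is a unique Haar system \((\nu^x)_{x\in L^0}\) on \(L\) such that \[ \int_{L^1} f(l)\,\mathrm d\nu^x(l)=\int_{H^1}\int_{L^1} f(l)\,\mathrm d\dot\lambda^{(h,x)}(l)\,\mathrm d\mu^{F^0(x)}(h) \] for all \(x\in L^0\) and all Borel functions \(f\) on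 \(L^1\) that vanish outside a quasi-compact subset and are either \([0,\infty]\)-valued, or \(\mathbb C\)-valued and \(\nu^x\)-integrable. -/

import Mathlib

open MeasureTheory Set Topology
open scoped ENNReal

section Spaces

/-- Every point has an open neighbourhood that is Hausdorff in the subspace topology. -/
def IsLocallyHausdorff (X : Type*) [TopologicalSpace X] : Prop :=
  ∀ x : X, ∃ U : Set X, IsOpen U ∧ x ∈ U ∧ T2Space U

/-- The space of quasi-continuous functions on a locally Hausdorff, locally compact space: finite
linear combinations of compactly supported continuous functions on Hausdorff open subsets,
extended by zero. -/
def quasiContinuous (X : Type*) [TopologicalSpace X] : Submodule ℂ (X → ℂ) :=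
  Submodule.span ℂ {f | ∃ U : Set X, IsOpen U ∧ T2Space U ∧ ContinuousOn f U ∧
    ∃ K : Set X, K ⊆ U ∧ IsCompact K ∧ ∀ x, x ∉ K → f x = 0}

end Spaces

section Families

variable {X : Type*} {Y : Type*} [TopologicalSpace X] [TopologicalSpace Y]

/-- The fibre of a map over a point, with the subspace topology and its Borel sets. -/
@[ext]
structure Fib {X : Type*} {Y : Type*} (p : X → Y) (y : Y) where
  val : X
  prop : p val = y

instance {Y : Type*} (p : X → Y) (y : Y) : TopologicalSpace (Fib p y) :=
  TopologicalSpace.induced Fib.val inferInstance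

instance {Y : Type*} (p : X → Y) (y : Y) : MeasurableSpace (Fib p y) := borel _

instance {Y : Type*} (p : X → Y) (y : Y) : BorelSpace (Fib p y) := ⟨rfl⟩

/-- A continuous family of measures along the fibres of `p`: a Radon measure on each fibre, such
that fibrewise integration maps quasi-continuous functions to quasi-continuous functions. -/
structure IsContinuousFamily (p : X → Y) (α : ∀ y, Measure (Fib p y)) : Prop where
  regular : ∀ y, (α y).Regular
  continuous : ∀ f ∈ quasiContinuous X, (fun y => ∫ x, f x.val ∂(α y)) ∈ quasiContinuous Y

end Families

/-- Topological groupoids with object space `X` and arrow space `A`, with open range and source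
maps. The product `mul a b _` is defined when `s a = r b`. -/
structure TopGroupoid (X : Type*) (A : Type*) [TopologicalSpace X] [TopologicalSpace A] where
  r : A → X
  s : A → X
  unit : X → A
  inv : A → A
  mul : (a b : A) → s a = r b → A
  r_unit : ∀ x, r (unit x) = x
  s_unit : ∀ x, s (unit x) = x
  r_inv : ∀ a, r (inv a) = s a
  s_inv : ∀ a, s (inv a) = r a
  r_mul : ∀ a b h, r (mul a b h) = r a
  s_mul : ∀ a b h, s (mul a b h) = s b
  mul_assoc : ∀ a b c (h : s a = r b) (h' : s b = r c),
    mul (mul a b h) c ((s_mul a b h).trans h') = mul a (mul b c h') (h.trans (r_mul b c h').symm)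
  unit_mul : ∀ a, mul (unit (r a)) a (s_unit _) = a
  mul_unit : ∀ a, mul a (unit (s a)) (r_unit _).symm = a
  inv_mul : ∀ a, mul (inv a) a (s_inv a) = unit (s a)
  mul_inv : ∀ a, mul a (inv a) (r_inv a).symm = unit (r a)
  continuous_r : Continuous r
  continuous_s : Continuous s
  continuous_unit : Continuous unit
  continuous_inv : Continuous inv
  continuous_mul : Continuous fun p : {p : A × A // s p.1 = r p.2} => mul p.1.1 p.1.2 p.2
  isOpenMap_r : IsOpenMap r
  isOpenMap_s : IsOpenMap s

namespace TopGroupoid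

variable {X : Type*} {A : Type*} [TopologicalSpace X] [TopologicalSpace A]

/-- Left translation `G^{s(k)} → G^{r(k)}`, `g ↦ k g`. -/
def leftMul (G : TopGroupoid X A) (k : A) (g : Fib G.r (G.s k)) : Fib G.r (G.r k) :=
  ⟨G.mul k g.val g.prop.symm, G.r_mul _ _ _⟩

/-- A (left) Haar system on a groupoid: a continuous family of measures along the fibres of the
range map that has full support and is left invariant. -/
structure IsHaarSystem (G : TopGroupoid X A) (α : ∀ x, Measure (Fib G.r x)) : Prop where
  isContinuousFamily : IsContinuousFamily G.r α
  full_support : ∀ x, (α x).IsOpenPosMeasure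
  left_invariant : ∀ k, (α (G.s k)).map (G.leftMul k) = α (G.r k)

/-- An idempotent arrow is a unit. -/
theorem eq_unit_of_mul_self (G : TopGroupoid X A) (a : A) (h : G.s a = G.r a)
    (ha : G.mul a a h = a) : a = G.unit (G.s a) := by
  have h1 := G.mul_assoc (G.inv a) a a (G.s_inv a) h
  have h2 : ∀ b c d (hb : G.s b = G.r d) (hc : G.s c = G.r d), b = c →
      G.mul b d hb = G.mul c d hc := by rintro b c d hb hc rfl; rfl
  have h3 : ∀ b c d (hb : G.s d = G.r b) (hc : G.s d = G.r c), b = c →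
      G.mul d b hb = G.mul d c hc := by rintro b c d hb hc rfl; rfl
  rw [h2 _ (G.unit (G.r a)) a _ (G.s_unit _) (by rw [G.inv_mul, h]), G.unit_mul,
    h3 _ a (G.inv a) _ (G.s_inv a) ha, G.inv_mul] at h1
  exact h1

theorem inv_inv (G : TopGroupoid X A) (a : A) : G.inv (G.inv a) = a := by
  have h1 := G.mul_assoc (G.inv (G.inv a)) (G.inv a) a (G.s_inv _) (G.s_inv _)
  have h2 : ∀ b c d (hb : G.s b = G.r d) (hc : G.s c = G.r d), b = c →
      G.mul b d hb = G.mul c d hc := by rintro b c d hb hc rfl; rfl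
  have h3 : ∀ b c d (hb : G.s d = G.r b) (hc : G.s d = G.r c), b = c →
      G.mul d b hb = G.mul d c hc := by rintro b c d hb hc rfl; rfl
  rw [h2 _ (G.unit (G.r a)) a _ (G.s_unit _) (by rw [G.inv_mul, G.s_inv]), G.unit_mul,
    h3 _ (G.unit (G.s (G.inv (G.inv a)))) _ _ (G.r_unit _).symm
      (by rw [G.inv_mul, G.s_inv, G.r_inv]), G.mul_unit] at h1
  exact h1.symm

end TopGroupoid

/-- A groupoid fibration `L → H`: a continuous functor for which the map
`(F¹, s) : L¹ → H¹ ×_{s, H⁰, F⁰} L⁰` is an open surjection. -/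
structure GroupoidFibration {L0 L1 H0 H1 : Type*} [TopologicalSpace L0] [TopologicalSpace L1]
    [TopologicalSpace H0] [TopologicalSpace H1] (L : TopGroupoid L0 L1) (H : TopGroupoid H0 H1)
    where
  obj : L0 → H0
  arr : L1 → H1
  continuous_obj : Continuous obj
  continuous_arr : Continuous arr
  r_arr : ∀ l, H.r (arr l) = obj (L.r l)
  s_arr : ∀ l, H.s (arr l) = obj (L.s l)
  arr_mul : ∀ a b (h : L.s a = L.r b), arr (L.mul a b h) =
    H.mul (arr a) (arr b) ((s_arr a).trans ((congrArg obj h).trans (r_arr b).symm))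
  isOpenMap_arr_s : IsOpenMap fun l =>
    (⟨(arr l, L.s l), s_arr l⟩ : {p : H1 × L0 // H.s p.1 = obj p.2})
  surjective_arr_s : Function.Surjective fun l =>
    (⟨(arr l, L.s l), s_arr l⟩ : {p : H1 × L0 // H.s p.1 = obj p.2})

namespace GroupoidFibration

variable {L0 L1 H0 H1 : Type*} [TopologicalSpace L0] [TopologicalSpace L1]
  [TopologicalSpace H0] [TopologicalSpace H1] {L : TopGroupoid L0 L1} {H : TopGroupoid H0 H1}

theorem arr_unit (F : GroupoidFibration L H) (x : L0) :
    F.arr (L.unit x) = H.unit (F.obj x) := by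
  have hs : L.s (L.unit x) = x := L.s_unit x
  have hx : L.s (L.unit x) = L.r (L.unit x) := by rw [L.s_unit, L.r_unit]
  have e : L.mul (L.unit x) (L.unit x) hx = L.unit x := by
    have h := L.unit_mul (L.unit x)
    have h2 : ∀ y (hy : L.s (L.unit y) = L.r (L.unit x)), y = x →
        L.mul (L.unit y) (L.unit x) hy = L.mul (L.unit x) (L.unit x) hx := by
      rintro y hy rfl; rfl
    rw [h2 _ _ (L.r_unit x)] at h
    exact h
  have h3 := F.arr_mul _ _ hx
  rw [e] at h3
  have h4 := H.eq_unit_of_mul_self (F.arr (L.unit x)) _ h3.symm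
  rw [h4, F.s_arr, hs]

/-- The arrow space of the fibre: arrows `g` with `F¹(g) = 1_{F⁰(s(g))}`. -/
abbrev FibreArrow (F : GroupoidFibration L H) : Type _ :=
  {g : L1 // F.arr g = H.unit (F.obj (L.s g))}

theorem obj_r_eq (F : GroupoidFibration L H) (g : F.FibreArrow) :
    F.obj (L.r g.1) = F.obj (L.s g.1) := by
  rw [← F.r_arr, g.2, H.r_unit]

theorem arr_mul_fibre (F : GroupoidFibration L H) (k : L1) (g : F.FibreArrow)
    (h : L.s k = L.r g.1) : F.arr (L.mul k g.1 h) = F.arr k := by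
  rw [F.arr_mul]
  have h2 : ∀ b (hb : H.s (F.arr k) = H.r b), b = H.unit (H.s (F.arr k)) →
      H.mul (F.arr k) b hb = F.arr k := by
    rintro b hb rfl; exact H.mul_unit _
  apply h2
  rw [g.2, F.s_arr, h, F.obj_r_eq]

theorem mul_mem_fibre (F : GroupoidFibration L H) (a b : F.FibreArrow)
    (h : L.s a.1 = L.r b.1) :
    F.arr (L.mul a.1 b.1 h) = H.unit (F.obj (L.s (L.mul a.1 b.1 h))) := by
  rw [F.arr_mul_fibre, a.2, L.s_mul, h, F.obj_r_eq]

theorem unit_mem_fibre (F : GroupoidFibration L H) (x : L0) :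
    F.arr (L.unit x) = H.unit (F.obj (L.s (L.unit x))) := by
  rw [F.arr_unit, L.s_unit]

theorem inv_mem_fibre (F : GroupoidFibration L H) (a : F.FibreArrow) :
    F.arr (L.inv a.1) = H.unit (F.obj (L.s (L.inv a.1))) := by
  have h := F.arr_mul_fibre (L.inv a.1) a (L.s_inv _)
  rw [L.inv_mul, F.arr_unit] at h
  rw [← h, L.s_inv, F.obj_r_eq]

theorem isOpenMap_s_fibre (F : GroupoidFibration L H) :
    IsOpenMap fun g : F.FibreArrow => L.s g.1 := by
  rintro _ ⟨O, hO, rfl⟩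
  have hc : Continuous fun x : L0 =>
      (⟨(H.unit (F.obj x), x), H.s_unit _⟩ : {p : H1 × L0 // H.s p.1 = F.obj p.2}) :=
    ((H.continuous_unit.comp F.continuous_obj).prodMk continuous_id).subtype_mk _
  convert (F.isOpenMap_arr_s O hO).preimage hc using 1
  ext x
  constructor
  · rintro ⟨g, hg, rfl⟩
    exact ⟨g.1, hg, Subtype.ext (Prod.ext g.2 rfl)⟩
  · rintro ⟨g, hg, e⟩
    have e1 : F.arr g = H.unit (F.obj x) := congrArg (fun p => p.1.1) e
    have e2 : L.s g = x := congrArg (fun p => p.1.2) e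
    exact ⟨⟨g, by rw [e1, e2]⟩, hg, e2⟩

theorem isOpenMap_r_fibre (F : GroupoidFibration L H) :
    IsOpenMap fun g : F.FibreArrow => L.r g.1 := by
  intro O hO
  have hc : Continuous fun g : F.FibreArrow =>
      (⟨L.inv g.1, F.inv_mem_fibre g⟩ : F.FibreArrow) :=
    (L.continuous_inv.comp continuous_subtype_val).subtype_mk _
  convert F.isOpenMap_s_fibre _ (hO.preimage hc) using 1
  ext x
  constructor
  · rintro ⟨g, hg, rfl⟩
    refine ⟨⟨L.inv g.1, F.inv_mem_fibre g⟩, ?_, L.s_inv _⟩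
    have : (⟨L.inv (L.inv g.1), F.inv_mem_fibre ⟨L.inv g.1, F.inv_mem_fibre g⟩⟩ :
      F.FibreArrow) = g := Subtype.ext (L.inv_inv _)
    simpa only [mem_preimage, this] using hg
  · rintro ⟨g, hg, rfl⟩
    exact ⟨_, hg, L.r_inv _⟩

theorem continuous_mul_fibre (F : GroupoidFibration L H) :
    Continuous fun p : {p : F.FibreArrow × F.FibreArrow // L.s p.1.1 = L.r p.2.1} =>
      (⟨L.mul p.1.1.1 p.1.2.1 p.2, F.mul_mem_fibre p.1.1 p.1.2 p.2⟩ : F.FibreArrow) := by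
  have h1 : Continuous fun p : {p : F.FibreArrow × F.FibreArrow // L.s p.1.1 = L.r p.2.1} =>
      (⟨(p.1.1.1, p.1.2.1), p.2⟩ : {p : L1 × L1 // L.s p.1 = L.r p.2}) :=
    Continuous.subtype_mk (by fun_prop) _
  exact Continuous.subtype_mk (L.continuous_mul.comp h1) _

/-- The fibre `G` of a groupoid fibration, with `G⁰ = L⁰` and the operations of `L`. -/
def fibre (F : GroupoidFibration L H) : TopGroupoid L0 F.FibreArrow where
  r g := L.r g.1
  s g := L.s g.1
  unit x := ⟨L.unit x, F.unit_mem_fibre x⟩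
  inv g := ⟨L.inv g.1, F.inv_mem_fibre g⟩
  mul a b h := ⟨L.mul a.1 b.1 h, F.mul_mem_fibre a b h⟩
  r_unit x := L.r_unit x
  s_unit x := L.s_unit x
  r_inv a := L.r_inv a.1
  s_inv a := L.s_inv a.1
  r_mul a b h := L.r_mul a.1 b.1 h
  s_mul a b h := L.s_mul a.1 b.1 h
  mul_assoc a b c h h' := Subtype.ext (L.mul_assoc a.1 b.1 c.1 h h')
  unit_mul a := Subtype.ext (L.unit_mul a.1)
  mul_unit a := Subtype.ext (L.mul_unit a.1)
  inv_mul a := Subtype.ext (L.inv_mul a.1)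
  mul_inv a := Subtype.ext (L.mul_inv a.1)
  continuous_r := L.continuous_r.comp continuous_subtype_val
  continuous_s := L.continuous_s.comp continuous_subtype_val
  continuous_unit := Continuous.subtype_mk L.continuous_unit F.unit_mem_fibre
  continuous_inv := Continuous.subtype_mk (L.continuous_inv.comp continuous_subtype_val) F.inv_mem_fibre
  continuous_mul := F.continuous_mul_fibre
  isOpenMap_r := F.isOpenMap_r_fibre
  isOpenMap_s := F.isOpenMap_s_fibre

/-- The space `H¹ ×_{r, H⁰, F⁰} L⁰`. -/
abbrev RangePullback (F : GroupoidFibration L H) : Type _ :=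
  {p : H1 × L0 // H.r p.1 = F.obj p.2}

/-- The map `(F¹, r) : L¹ → H¹ ×_{r, H⁰, F⁰} L⁰`. -/
def arrRange (F : GroupoidFibration L H) (l : L1) : F.RangePullback :=
  ⟨(F.arr l, L.r l), F.r_arr l⟩

/-- For `k ∈ L¹`, the map `g ↦ k g` from `G^{s(k)}` to the fibre of `(F¹, r)` through `k`. -/
def translate (F : GroupoidFibration L H) (k : L1) (g : Fib F.fibre.r (L.s k)) :
    Fib F.arrRange (F.arrRange k) :=
  ⟨L.mul k g.val.1 g.prop.symm,
    Subtype.ext (Prod.ext (F.arr_mul_fibre k g.val g.prop.symm) (L.r_mul _ _ _))⟩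

/-- The measures `dlam` on the fibres of `(F¹, r)` are those transported from the family `lam`
on the fibre groupoid: `∫ f(l) d dlam^{(h,x)}(l) = ∫ f(k g) d lam^{s(k)}(g)` for every `k ∈ L¹`
with `F¹(k) = h` and `r(k) = x`. -/
def IsTransported (F : GroupoidFibration L H) (lam : ∀ x, Measure (Fib F.fibre.r x))
    (dlam : ∀ p, Measure (Fib F.arrRange p)) : Prop :=
  ∀ k : L1, dlam (F.arrRange k) = (lam (L.s k)).map (F.translate k)

/-- The iterated integration formula
`∫ f dν^x = ∫_{H¹} ∫_{L¹} f(l) d dlam^{(h,x)}(l) d mu^{F⁰(x)}(h)`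
for Borel functions with quasi-compact support: for nonnegative functions, and for complex-valued
functions that are integrable. -/
structure IsIterated (F : GroupoidFibration L H) (mu : ∀ y, Measure (Fib H.r y))
    (dlam : ∀ p, Measure (Fib F.arrRange p)) (nu : ∀ x, Measure (Fib L.r x)) : Prop where
  lintegral_eq : ∀ (x : L0) (f : L1 → ℝ≥0∞), Measurable[borel L1] f →
    (∃ K : Set L1, IsCompact K ∧ ∀ l, l ∉ K → f l = 0) →
    ∫⁻ l, f l.val ∂(nu x) =
      ∫⁻ h : Fib H.r (F.obj x), ∫⁻ l, f l.val ∂(dlam ⟨(h.val, x), h.prop⟩) ∂(mu (F.obj x))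
  integral_eq : ∀ (x : L0) (f : L1 → ℂ), Measurable[borel L1] f →
    (∃ K : Set L1, IsCompact K ∧ ∀ l, l ∉ K → f l = 0) →
    Integrable (fun l : Fib L.r x => f l.val) (nu x) →
    ∫ l, f l.val ∂(nu x) =
      ∫ h : Fib H.r (F.obj x), ∫ l, f l.val ∂(dlam ⟨(h.val, x), h.prop⟩) ∂(mu (F.obj x))

end GroupoidFibration

/-! For fixed `x`, the map `F¹` restricts to an open surjection `L^x → H^{F⁰(x)}`, and its fibre
through `k` is the translate `k G^{s(k)}`. Translating `λ^{s(k)}` by `k` gives a measure on this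
fibre. Two choices of `k` differ by an arrow of `G`, so left invariance of `λ` makes the measure
independent of the choice (`map_translateHomeomorph_eq`). The measure `ν^x` is then the composite of
`μ^{F⁰(x)}` with these fibre measures.

The topology of `L¹` is controlled by the division `(k, l) ↦ k⁻¹ l ∈ G`, defined when `k` and `l`
have the same image under `(F¹, r)`. Together with that image, it transfers local Hausdorffness and
local compactness from `G` and `H¹ × L⁰` to `L¹`.

The analytic core is one continuity theorem, `FibreCorrespondence.continuousAt_integral`: an
integral over the fibre of `p` above `q z` depends continuously on `z`, also when the integrand
varies with `z`. Near `z₀` the integrand is compared with a fixed function, a Tietze extension of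
its value at `z₀`, and the error is dominated by a small multiple of a fixed cutoff. This is applied
to the transported family, to its restriction to one `L^x`, and to the pullback of `μ` along `F⁰`.

Although `L¹` need not be Hausdorff, each `L^x` is (`t2Space_fib_r`), so classical Radon measure
theory is available there. The composite comes from the Riesz theorem. The iterated formula passes
from `C_c` to relatively compact open sets by `τ`-smoothness, and then to Borel functions by a
π-system argument (`composite_apply_isOpen`, `bind_restrict`). Full support and invariance are
checked on `C_c(L^x)`, and so is uniqueness, after extending test functions by zero to Borel
functions on `L¹`. -/

set_option linter.unusedSectionVars false

/-! ### Composition of a Radon measure with a kernel on locally compact Hausdorff spaces -/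

section Disintegration

open scoped CompactlySupported NNReal
open Filter

variable {S T : Type*} [TopologicalSpace S] [T2Space S] [LocallyCompactSpace S]
  [MeasurableSpace S] [BorelSpace S] [TopologicalSpace T] [T2Space T] [LocallyCompactSpace T]
  [MeasurableSpace T] [BorelSpace T]

/-- A Radon measure is `τ`-smooth: a bound on the integrals of a directed family of continuous
functions is a bound on the integral of any compactly supported function below their supremum. -/
theorem lintegral_le_of_directed_continuous {μ : Measure S} [μ.Regular] {ι : Type*} [Nonempty ι]
    {φ : ι → S → ℝ≥0} (hφ : ∀ i, Continuous (φ i)) (hdir : Directed (· ≤ ·) φ)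
    {Φ : S → ℝ≥0} {C : Set S} (hC : IsCompact C) (hΦC : ∀ s, s ∉ C → Φ s = 0)
    (hΦ : ∀ s, ∀ r < Φ s, ∃ i, r < φ i s) (hfin : ∫⁻ s, Φ s ∂μ ≠ ∞) {M : ℝ≥0∞}
    (hM : ∀ i, ∫⁻ s, φ i s ∂μ ≤ M) : ∫⁻ s, Φ s ∂μ ≤ M := by
  have hμC : μ C ≠ ∞ := hC.measure_lt_top.ne
  have : (μ.restrict C).Regular := Measure.Regular.restrict_of_measure_ne_top hμC
  have hle : ∫⁻ s, Φ s ∂(μ.restrict C) = ∫⁻ s, Φ s ∂μ := by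
    apply setLIntegral_eq_of_support_subset
    intro s hs
    by_contra h
    exact hs (by simp [hΦC s h])
  have key : ∀ ε : ℝ≥0, 0 < ε → ∫⁻ s, Φ s ∂μ ≤ M + ε * μ C + ε := by
    intro ε hε
    -- Vitali–Carathéodory from below: an upper semicontinuous minorant makes the sets `{g < φ i +
    -- ε}` open. They are directed and cover `C`, so compactness yields one index valid on all of
    -- `C`.
    obtain ⟨g, hgΦ, hgu, hg⟩ := exists_upperSemicontinuous_le_lintegral_le (μ := μ.restrict C) Φ
      (by rwa [hle]) (ε := ε) (by simpa using hε.ne')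
    obtain ⟨i, hi⟩ := hC.elim_directed_cover (fun i => {s | g s < φ i s + ε}) (fun i => by
        refine isOpen_iff_mem_nhds.2 fun s hs => ?_
        obtain ⟨r, h1, h2⟩ := exists_between (show g s < φ i s + ε from hs)
        filter_upwards [hgu s r h1, (((hφ i).add continuous_const).tendsto s).eventually
          (lt_mem_nhds h2)] with t h3 h4 using h3.trans h4)
      (fun s _ => by
        rw [mem_iUnion]
        by_cases h : g s < ε
        · exact ⟨Classical.arbitrary ι, h.trans_le (by simp)⟩
        · obtain ⟨i, hi⟩ := hΦ s (g s - ε) ((tsub_lt_self (hε.trans_le (not_lt.1 h)) hε).trans_le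
            (hgΦ s))
          exact ⟨i, (tsub_lt_iff_right (not_lt.1 h)).1 hi⟩)
      (fun i j => by
        obtain ⟨k, h1, h2⟩ := hdir i j
        exact ⟨k, fun s (hs : g s < φ i s + ε) => hs.trans_le (add_le_add (h1 s) le_rfl),
          fun s (hs : g s < φ j s + ε) => hs.trans_le (add_le_add (h2 s) le_rfl)⟩)
    calc ∫⁻ s, Φ s ∂μ ≤ ∫⁻ s in C, g s ∂μ + ε := by rw [← hle]; exact hg
      _ ≤ ∫⁻ s in C, (φ i s + ε : ℝ≥0∞) ∂μ + ε := by
        gcongr 1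
        refine setLIntegral_mono' hC.measurableSet fun s hs => ?_
        exact_mod_cast (hi hs).le
      _ ≤ M + ε * μ C + ε := by
        rw [lintegral_add_right _ measurable_const]
        gcongr
        · exact (setLIntegral_le_lintegral _ _).trans (hM i)
        · simp
  refine ENNReal.le_of_forall_pos_le_add fun ε hε hM' => ?_
  -- Chosen so that the total error, this number times `μ C + 1`, is exactly `ε`.
  have h1 : 0 < ε / ((μ C).toNNReal + 1) := by positivity
  refine (key _ h1).trans ?_
  rw [add_assoc]
  gcongr
  have : μ C = (μ C).toNNReal := (ENNReal.coe_toNNReal hμC).symm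
  rw [this]
  norm_cast
  rw [← mul_add_one, div_mul_cancel₀]
  positivity

/-- A family of measures for which fibre integration maps `C_c(T)` to `C_c(S)`. -/
structure IsRadonKernel (κ : S → Measure T) : Prop where
  finite : ∀ h, IsFiniteMeasureOnCompacts (κ h)
  inner : ∀ h, (κ h).InnerRegularWRT IsCompact IsOpen
  continuous : ∀ f : C_c(T, ℝ), Continuous fun h => ∫ t, f t ∂(κ h)
  support : ∀ f : C_c(T, ℝ), HasCompactSupport fun h => ∫ t, f t ∂(κ h)

namespace IsRadonKernel

variable {κ : S → Measure T}

/-- The positive functional `f ↦ ∫ ∫ f dκ dμ`. -/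
noncomputable def functional (hκ : IsRadonKernel κ) (μ : Measure S) [μ.Regular] :
    C_c(T, ℝ) →ₚ[ℝ] ℝ :=
  PositiveLinearMap.mk₀
    { toFun f := ∫ h, ∫ t, f t ∂(κ h) ∂μ
      map_add' f g := by
        have := hκ.finite
        rw [← integral_add ((hκ.continuous f).integrable_of_hasCompactSupport (hκ.support f))
          ((hκ.continuous g).integrable_of_hasCompactSupport (hκ.support g))]
        exact integral_congr_ae (.of_forall fun h => integral_add f.integrable g.integrable)
      map_smul' c f := by
        simp only [CompactlySupportedContinuousMap.smul_apply, integral_smul, RingHom.id_apply] }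
    fun _ hf => integral_nonneg fun _ => integral_nonneg hf

/-- The composite of a measure with a Radon kernel. -/
noncomputable def composite (hκ : IsRadonKernel κ) (μ : Measure S) [μ.Regular] : Measure T :=
  RealRMK.rieszMeasure (hκ.functional μ)

instance (hκ : IsRadonKernel κ) (μ : Measure S) [μ.Regular] : (hκ.composite μ).Regular :=
  RealRMK.regular_rieszMeasure _

theorem integral_composite_compactlySupported (hκ : IsRadonKernel κ) (μ : Measure S) [μ.Regular]
    (f : C_c(T, ℝ)) : ∫ t, f t ∂(hκ.composite μ) = ∫ h, ∫ t, f t ∂(κ h) ∂μ :=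
  RealRMK.integral_rieszMeasure _ f

theorem lintegral_eq_ofReal (m : Measure T) [IsFiniteMeasureOnCompacts m] (f : C_c(T, ℝ))
    (hf : 0 ≤ f) : ∫⁻ t, ENNReal.ofReal (f t) ∂m = ENNReal.ofReal (∫ t, f t ∂m) :=
  (ofReal_integral_eq_lintegral_ofReal f.integrable (.of_forall hf)).symm

theorem lintegral_composite_compactlySupported (hκ : IsRadonKernel κ) (μ : Measure S) [μ.Regular]
    (f : C_c(T, ℝ)) (hf : 0 ≤ f) : ∫⁻ t, ENNReal.ofReal (f t) ∂(hκ.composite μ) =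
      ∫⁻ h, ENNReal.ofReal (∫ t, f t ∂(κ h)) ∂μ := by
  rw [lintegral_eq_ofReal _ f hf, hκ.integral_composite_compactlySupported,
    ofReal_integral_eq_lintegral_ofReal
      ((hκ.continuous f).integrable_of_hasCompactSupport (hκ.support f))
      (.of_forall fun h => integral_nonneg hf)]

/-- The compactly supported functions with values in `[0,1]` that vanish off `O`. -/
def Below (O : Set T) : Type _ :=
  {f : C_c(T, ℝ) // 0 ≤ f ∧ (∀ t, f t ≤ 1) ∧ ∀ t, t ∉ O → f t = 0}

instance (O : Set T) : Nonempty (Below O) :=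
  ⟨⟨0, le_rfl, fun _ => zero_le_one, fun _ _ => rfl⟩⟩

theorem Below.lintegral_le {O : Set T} (hO : IsOpen O) (f : Below O) (m : Measure T) :
    ∫⁻ t, ENNReal.ofReal (f.1 t) ∂m ≤ m O := by
  rw [← lintegral_indicator_one hO.measurableSet]
  refine lintegral_mono fun t => ?_
  by_cases h : t ∈ O
  · simpa [h] using f.2.2.1 t
  · simp [h, f.2.2.2 t h]

theorem exists_cutoff {K O : Set T} (hK : IsCompact K) (hO : IsOpen O) (hKO : K ⊆ O) :
    ∃ f : Below O, ∀ t ∈ K, f.1 t = 1 := by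
  obtain ⟨f, h1, h2, h3, h4⟩ := exists_continuous_one_zero_of_isCompact hK hO.isClosed_compl
    (disjoint_compl_right_iff_subset.2 hKO)
  exact ⟨⟨⟨f, h3⟩, fun t => (h4 t).1, fun t => (h4 t).2, fun t ht => h2 ht⟩, fun t ht => h1 ht⟩

theorem measure_le_lintegral {K : Set T} (hK : IsCompact K) (m : Measure T) (f : C_c(T, ℝ))
    (hf : ∀ t ∈ K, f t = 1) : m K ≤ ∫⁻ t, ENNReal.ofReal (f t) ∂m := by
  rw [← lintegral_indicator_one hK.measurableSet]
  refine lintegral_mono fun t => ?_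
  by_cases h : t ∈ K
  · simp [h, hf t h]
  · simp [h]

theorem exists_below {m : Measure T} (hm : m.InnerRegularWRT IsCompact IsOpen)
    {O : Set T} (hO : IsOpen O) {r : ℝ≥0∞} (hr : r < m O) :
    ∃ f : Below O, r < ∫⁻ t, ENNReal.ofReal (f.1 t) ∂m := by
  obtain ⟨K, hKO, hK, hrK⟩ := hm hO r hr
  obtain ⟨f, hf⟩ := exists_cutoff hK hO hKO
  exact ⟨f, hrK.trans_le (measure_le_lintegral hK m f.1 hf)⟩

/-- By inner regularity and Urysohn, `κ h O` is the supremum of the continuous functions `h ↦ ∫ f dκ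
h` over `f` in `Below O`, hence lower semicontinuous in `h`. -/
theorem measurable_apply_isOpen (hκ : IsRadonKernel κ) {O : Set T} (hO : IsOpen O) :
    Measurable fun h => κ h O := by
  refine LowerSemicontinuous.measurable fun h r hr => ?_
  have := hκ.finite
  obtain ⟨f, hf⟩ := exists_below (hκ.inner h) hO hr
  rw [lintegral_eq_ofReal _ _ f.2.1] at hf
  filter_upwards [((ENNReal.continuous_ofReal.comp (hκ.continuous f.1)).tendsto h).eventually
    (lt_mem_nhds hf)] with h' hh'
  refine lt_of_lt_of_le hh' ?_
  rw [Function.comp, ← lintegral_eq_ofReal _ _ f.2.1]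
  exact f.lintegral_le hO _

/-- Integrating a cutoff equal to `1` on `C` gives the bound. It makes `κ` uniformly finite on `C`,
and zero there for `h` outside a compact set. -/
theorem exists_bound (hκ : IsRadonKernel κ) {C : Set T} (hC : IsCompact C) :
    ∃ φ : S → ℝ, Continuous φ ∧ HasCompactSupport φ ∧ ∀ h, κ h C ≤ ENNReal.ofReal (φ h) := by
  obtain ⟨f, hf⟩ := exists_cutoff hC isOpen_univ (subset_univ C)
  refine ⟨_, hκ.continuous f.1, hκ.support f.1, fun h => ?_⟩
  have := hκ.finite
  rw [← lintegral_eq_ofReal _ _ f.2.1]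
  exact measure_le_lintegral hC _ f.1 hf

/-- Both sides are suprema over the test functions in `Below O`. One inequality is inner regularity
of the composite. The other interchanges a supremum with `∫ dμ` over a possibly uncountable directed
family, so it needs `τ`-smoothness instead of monotone convergence. -/
theorem composite_apply_isOpen (hκ : IsRadonKernel κ) (μ : Measure S) [μ.Regular] {O C : Set T}
    (hO : IsOpen O) (hC : IsCompact C) (hOC : O ⊆ C) :
    hκ.composite μ O = ∫⁻ h, κ h O ∂μ := by
  have := hκ.finite
  apply le_antisymm
  · refine le_of_forall_lt fun r hr => ?_
    obtain ⟨f, hf⟩ := exists_below Measure.Regular.innerRegular hO hr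
    refine hf.trans_le ?_
    rw [hκ.lintegral_composite_compactlySupported μ _ f.2.1]
    refine lintegral_mono fun h => ?_
    rw [← lintegral_eq_ofReal _ _ f.2.1]
    exact f.lintegral_le hO _
  · obtain ⟨φ, hφc, hφs, hφ⟩ := hκ.exists_bound hC
    have hne : ∀ h, κ h O ≠ ∞ := fun h => ((measure_mono hOC).trans_lt
      ((hφ h).trans_lt ENNReal.ofReal_lt_top)).ne
    have hcoe : ∀ h, κ h O = (κ h O).toNNReal := fun h => (ENNReal.coe_toNNReal (hne h)).symm
    rw [lintegral_congr hcoe]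
    refine lintegral_le_of_directed_continuous
      (φ := fun (f : Below O) h => (∫ t, f.1 t ∂(κ h)).toNNReal)
      (fun f => continuous_real_toNNReal.comp (hκ.continuous f.1)) (fun f g => ?_) hφs
      (fun h hh => ?_) (fun h r hr => ?_) ?_ (fun f => ?_)
    · refine ⟨⟨f.1 ⊔ g.1, f.2.1.trans le_sup_left, fun t => sup_le (f.2.2.1 t) (g.2.2.1 t),
        fun t ht => by simp [f.2.2.2 t ht, g.2.2.2 t ht]⟩, fun h => ?_, fun h => ?_⟩
      · exact Real.toNNReal_mono (integral_mono f.1.integrable (f.1 ⊔ g.1).integrable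
          fun t => le_sup_left)
      · exact Real.toNNReal_mono (integral_mono g.1.integrable (f.1 ⊔ g.1).integrable
          fun t => le_sup_right)
    · have h1 := (measure_mono hOC).trans (hφ h)
      rw [image_eq_zero_of_notMem_tsupport hh, ENNReal.ofReal_zero, nonpos_iff_eq_zero] at h1
      simp [h1]
    · have hr' : (r : ℝ≥0∞) < κ h O := by rw [hcoe]; exact_mod_cast hr
      obtain ⟨f, hf⟩ := exists_below (hκ.inner h) hO hr'
      rw [lintegral_eq_ofReal _ _ f.2.1] at hf
      exact ⟨f, ENNReal.coe_lt_coe.1 hf⟩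
    · rw [← lintegral_congr hcoe]
      refine ((lintegral_mono fun h => (measure_mono hOC).trans (hφ h)).trans_lt ?_).ne
      exact (hφc.integrable_of_hasCompactSupport hφs).lintegral_lt_top
    · change ∫⁻ h, ENNReal.ofReal _ ∂μ ≤ _
      rw [← hκ.lintegral_composite_compactlySupported μ _ f.2.1]
      exact f.lintegral_le hO _

theorem measurable_restrict (hκ : IsRadonKernel κ) {O C : Set T}
    (hO : IsOpen O) (hC : IsCompact C) (hOC : O ⊆ C) : Measurable fun h => (κ h).restrict O := by
  have hfin : ∀ h, IsFiniteMeasure ((κ h).restrict O) := fun h => by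
    have := hκ.finite h
    exact ⟨by simpa using (measure_mono hOC).trans_lt hC.measure_lt_top⟩
  refine Measurable.measure_of_isPiSystem (BorelSpace.measurable_eq (α := T)) isPiSystem_isOpen
    (fun s hs => ?_) ?_
  · simp_rw [Measure.restrict_apply (IsOpen.measurableSet hs)]
    exact hκ.measurable_apply_isOpen (IsOpen.inter hs hO)
  · simpa using hκ.measurable_apply_isOpen hO

/-- Open sets form a generating π-system. Restricting to a relatively compact `O` makes the
composite finite, as uniqueness on a π-system requires. -/
theorem bind_restrict (hκ : IsRadonKernel κ) (μ : Measure S) [μ.Regular] {O C : Set T}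
    (hO : IsOpen O) (hC : IsCompact C) (hOC : O ⊆ C) :
    μ.bind (fun h => (κ h).restrict O) = (hκ.composite μ).restrict O := by
  have hm := hκ.measurable_restrict hO hC hOC
  have hfin : IsFiniteMeasure ((hκ.composite μ).restrict O) :=
    ⟨by simpa using (measure_mono hOC).trans_lt hC.measure_lt_top⟩
  symm
  refine ext_of_generate_finite _ (BorelSpace.measurable_eq (α := T)) isPiSystem_isOpen
    (fun s hs => ?_) ?_
  · rw [Measure.bind_apply (IsOpen.measurableSet hs) hm.aemeasurable]
    simp_rw [Measure.restrict_apply (IsOpen.measurableSet hs)]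
    exact hκ.composite_apply_isOpen μ (IsOpen.inter hs hO) hC (inter_subset_right.trans hOC)
  · rw [Measure.bind_apply .univ hm.aemeasurable]
    simpa using hκ.composite_apply_isOpen μ hO hC hOC

theorem lintegral_composite (hκ : IsRadonKernel κ) (μ : Measure S) [μ.Regular] {f : T → ℝ≥0∞}
    (hf : Measurable f) {K : Set T} (hK : IsCompact K) (hfK : ∀ t, t ∉ K → f t = 0) :
    ∫⁻ t, f t ∂(hκ.composite μ) = ∫⁻ h, ∫⁻ t, f t ∂(κ h) ∂μ := by
  obtain ⟨O, hO, hKO, hC⟩ := exists_isOpen_superset_and_isCompact_closure hK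
  have hs : Function.support f ⊆ O := fun t ht => hKO (by_contra fun h => ht (hfK t h))
  have h := Measure.lintegral_bind (hκ.measurable_restrict hO hC subset_closure).aemeasurable
    hf.aemeasurable (m := μ)
  rw [hκ.bind_restrict μ hO hC subset_closure, setLIntegral_eq_of_support_subset hs] at h
  simp_rw [setLIntegral_eq_of_support_subset hs] at h
  exact h

theorem integral_composite (hκ : IsRadonKernel κ) (μ : Measure S) [μ.Regular] {f : T → ℂ}
    (hf : Integrable f (hκ.composite μ)) {K : Set T} (hK : IsCompact K)
    (hfK : ∀ t, t ∉ K → f t = 0) :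
    ∫ t, f t ∂(hκ.composite μ) = ∫ h, ∫ t, f t ∂(κ h) ∂μ := by
  obtain ⟨O, hO, hKO, hC⟩ := exists_isOpen_superset_and_isCompact_closure hK
  have hs : ∀ t, t ∉ O → f t = 0 := fun t ht => hfK t fun h => ht (hKO h)
  obtain ⟨φ, hφc, hφs, hφ⟩ := hκ.exists_bound hC
  let D := tsupport φ
  have hD : ∀ h, h ∉ D → (κ h).restrict O = 0 := fun h hh => by
    have h1 := (measure_mono subset_closure).trans (hφ h)
    rw [image_eq_zero_of_notMem_tsupport hh, ENNReal.ofReal_zero, nonpos_iff_eq_zero] at h1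
    exact Measure.restrict_eq_zero.2 h1
  have hm := hκ.measurable_restrict hO hC subset_closure
  let η : ProbabilityTheory.Kernel S T := ⟨fun h => (κ h).restrict O, hm⟩
  obtain ⟨b, hb⟩ := hφs.exists_bound_of_continuous hφc
  have hη : ProbabilityTheory.IsFiniteKernel η := by
    refine ⟨ENNReal.ofReal b, ENNReal.ofReal_lt_top, fun h => ?_⟩
    change (κ h).restrict O univ ≤ _
    rw [Measure.restrict_apply_univ]
    exact ((measure_mono subset_closure).trans (hφ h)).trans
      (ENNReal.ofReal_le_ofReal ((le_abs_self _).trans (hb h)))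
  -- The kernel restricted to `O` vanishes off `D`, so `μ` may be cut down to `D`. Finiteness then
  -- lets `Kernel.integral_comp` apply, with `μ.restrict D` viewed as a kernel from a point.
  have : IsFiniteMeasure (μ.restrict D) :=
    ⟨by simpa using hφs.isCompact.measure_lt_top⟩
  let ξ : ProbabilityTheory.Kernel Unit S := ProbabilityTheory.Kernel.const Unit (μ.restrict D)
  have hcomp : (ProbabilityTheory.Kernel.comp η ξ) () = (hκ.composite μ).restrict O := by
    rw [ProbabilityTheory.Kernel.comp_apply, ← hκ.bind_restrict μ hO hC subset_closure]
    ext s hs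
    rw [Measure.bind_apply hs η.measurable.aemeasurable, Measure.bind_apply hs hm.aemeasurable]
    change ∫⁻ h in D, (κ h).restrict O s ∂μ = _
    refine setLIntegral_eq_of_support_subset fun h hh => by_contra fun hc => hh ?_
    simp [hD h hc]
  have h := ProbabilityTheory.Kernel.integral_comp (κ := ξ) (η := η) (a := ()) (f := f)
    (by rw [hcomp]; exact hf.restrict)
  rw [hcomp, setIntegral_eq_integral_of_forall_compl_eq_zero hs] at h
  rw [h]
  change ∫ h in D, ∫ t in O, f t ∂(κ h) ∂μ = _
  simp_rw [setIntegral_eq_integral_of_forall_compl_eq_zero hs]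
  refine setIntegral_eq_integral_of_forall_compl_eq_zero fun h hh => ?_
  rw [← setIntegral_eq_integral_of_forall_compl_eq_zero hs, hD h hh, integral_zero_measure]

end IsRadonKernel

end Disintegration

/-! ### Functions with compact support in Hausdorff open subsets -/

section CompactSupport

open Filter

variable {X : Type*} [TopologicalSpace X]

/-- Functions that are continuous on `U` and vanish off a compact subset of `U`. -/
def CcOn (U : Set X) (f : X → ℂ) : Prop :=
  ContinuousOn f U ∧ ∃ K : Set X, K ⊆ U ∧ IsCompact K ∧ ∀ x, x ∉ K → f x = 0

theorem CcOn.mem_quasiContinuous {U : Set X} (hU : IsOpen U) [T2Space U] {f : X → ℂ}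
    (hf : CcOn U f) : f ∈ quasiContinuous X :=
  Submodule.subset_span ⟨U, hU, inferInstance, hf⟩

theorem quasiContinuous_induction {P : (X → ℂ) → Prop} (h0 : P 0)
    (hadd : ∀ f g, P f → P g → P (f + g)) (hsmul : ∀ (c : ℂ) f, P f → P (c • f))
    (hP : ∀ U : Set X, IsOpen U → T2Space U → ∀ f, CcOn U f → P f) {f : X → ℂ}
    (hf : f ∈ quasiContinuous X) : P f := by
  induction hf using Submodule.span_induction with
  | mem f h => obtain ⟨U, hU, hU2, hf⟩ := h; exact hP U hU hU2 f hf
  | zero => exact h0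
  | add f g _ _ hf hg => exact hadd f g hf hg
  | smul c f _ hf => exact hsmul c f hf

/-- Integration maps quasi-continuous functions to quasi-continuous functions if it does so for
functions with compact support in Hausdorff open sets. -/
theorem integral_mem_quasiContinuous {Y : Type*} [TopologicalSpace Y] {D : Y → Type*}
    [∀ y, MeasurableSpace (D y)] {β : ∀ y, Measure (D y)} {v : ∀ y, D y → X}
    (h : ∀ U : Set X, IsOpen U → T2Space U → ∀ f, CcOn U f →
      (∀ y, Integrable (fun d => f (v y d)) (β y)) ∧
        (fun y => ∫ d, f (v y d) ∂(β y)) ∈ quasiContinuous Y)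
    {f : X → ℂ} (hf : f ∈ quasiContinuous X) :
    (fun y => ∫ d, f (v y d) ∂(β y)) ∈ quasiContinuous Y := by
  -- Integrability is carried through the induction because additivity of the Bochner integral needs
  -- it.
  refine (quasiContinuous_induction (P := fun f => (∀ y, Integrable (fun d => f (v y d)) (β y)) ∧
    (fun y => ∫ d, f (v y d) ∂(β y)) ∈ quasiContinuous Y)
    ⟨fun y => integrable_zero _ _ _, ?_⟩ ?_ ?_ h hf).2
  · convert Submodule.zero_mem _ using 1
    ext y
    simp
  · rintro f g ⟨hf, hf'⟩ ⟨hg, hg'⟩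
    refine ⟨fun y => (hf y).add (hg y), ?_⟩
    convert Submodule.add_mem _ hf' hg' using 1
    ext y
    exact integral_add (hf y) (hg y)
  · rintro c f ⟨hf, hf'⟩
    refine ⟨fun y => (hf y).smul c, ?_⟩
    convert Submodule.smul_mem _ c hf' using 1
    ext y
    exact integral_smul c _

/-- A compact `K` need not be closed in a non-Hausdorff `X`, so extension by zero may be
discontinuous. Pulled back to a Hausdorff `W`, a compact support is closed and the difficulty
disappears. -/
theorem continuous_comp_of_isCompact_preimage {W E : Type*} [TopologicalSpace W] [T2Space W]
    [TopologicalSpace E] [Zero E]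
    {U K : Set X} {f : X → E} (hU : IsOpen U) (hf : ContinuousOn f U) (hKU : K ⊆ U)
    (hfK : ∀ x, x ∉ K → f x = 0) {j : W → X} (hj : Continuous j) (hK : IsCompact (j ⁻¹' K)) :
    Continuous fun w => f (j w) := by
  refine continuous_iff_continuousAt.2 fun w => ?_
  by_cases h : j w ∈ U
  · exact (hf.continuousAt (hU.mem_nhds h)).comp hj.continuousAt
  · have hw : w ∈ (j ⁻¹' K)ᶜ := fun h' => h (hKU h')
    refine (continuousAt_const (y := (0 : E))).congr ?_
    filter_upwards [hK.isClosed.isOpen_compl.mem_nhds hw] with v hv using (hfK _ hv).symm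

theorem CcOn.mono {U V : Set X} (hV : IsOpen V) (hVU : V ⊆ U) [T2Space U]
    {f : X → ℂ} (hf : CcOn V f) : CcOn U f := by
  obtain ⟨hc, K, hKV, hK, hfK⟩ := hf
  refine ⟨?_, K, hKV.trans hVU, hK, hfK⟩
  rw [continuousOn_iff_continuous_domRestrict]
  refine continuous_comp_of_isCompact_preimage hV hc hKV hfK continuous_subtype_val ?_
  exact IsInducing.subtypeVal.isCompact_preimage_iff (by simpa using hKV.trans hVU) |>.2 hK

theorem CcOn.add {U : Set X} [T2Space U] {f g : X → ℂ} (hf : CcOn U f) (hg : CcOn U g) :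
    CcOn U (f + g) := by
  obtain ⟨hc, K, hKV, hK, hfK⟩ := hf
  obtain ⟨hc', K', hKV', hK', hfK'⟩ := hg
  refine ⟨hc.add hc', K ∪ K', union_subset hKV hKV', hK.union hK', fun x hx => ?_⟩
  simp [hfK x fun h => hx (.inl h), hfK' x fun h => hx (.inr h)]

theorem CcOn.zero (U : Set X) : CcOn U 0 :=
  ⟨continuousOn_const, ∅, empty_subset _, isCompact_empty, fun _ _ => rfl⟩

theorem ccOn_extend {U : Set X} {φ : U → ℂ} (hφ : Continuous φ) (hs : HasCompactSupport φ) :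
    CcOn U (Function.extend Subtype.val φ 0) := by
  have h : ∀ x : U, Function.extend Subtype.val φ 0 x.1 = φ x :=
    fun x => Subtype.val_injective.extend_apply _ _ _
  refine ⟨?_, Subtype.val '' tsupport φ, by simp, hs.isCompact.image continuous_subtype_val,
    fun x hx => ?_⟩
  · rw [continuousOn_iff_continuous_domRestrict]
    exact hφ.congr fun x => (h x).symm
  · by_cases hxU : x ∈ U
    · rw [h ⟨x, hxU⟩]
      exact image_eq_zero_of_notMem_tsupport fun h' => hx ⟨_, h', rfl⟩
    · rw [Function.extend_apply' _ _ _ fun ⟨a, ha⟩ => hxU (ha ▸ a.2)]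
      rfl

/-- Localization by a partition of unity: to prove an additive property of functions with compact
support in a Hausdorff open set, it suffices to prove it locally. -/
theorem CcOn.induction_local [LocallyCompactSpace X] {U : Set X} (hU : IsOpen U) [T2Space U]
    {P : (X → ℂ) → Prop} (h0 : P 0) (hadd : ∀ f g, P f → P g → P (f + g))
    (hP : ∀ x ∈ U, ∃ O, IsOpen O ∧ x ∈ O ∧ ∀ g, CcOn (U ∩ O) g → P g) {f : X → ℂ}
    (hf : CcOn U f) : P f := by
  obtain ⟨hc, K, hKU, hK, hfK⟩ := hf
  have := hU.locallyCompactSpace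
  choose! O hO hxO hOP using hP
  have hK' : IsCompact ((↑) ⁻¹' K : Set U) :=
    IsInducing.subtypeVal.isCompact_preimage_iff (by simpa using hKU) |>.2 hK
  obtain ⟨t, ht⟩ := hK'.elim_finite_subcover (fun x : U => ((↑) ⁻¹' O x : Set U))
    (fun x => (hO x x.2).preimage continuous_subtype_val)
    (fun x _ => mem_iUnion.2 ⟨x, mem_preimage.2 (hxO x x.2)⟩)
  -- The partition of unity is taken in the subspace `U`, which is Hausdorff, and the pieces `φ i *
  -- f` are extended by zero.
  obtain ⟨φ, h1, h2, -, h4⟩ := exists_continuous_sum_one_of_isOpen_isCompact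
    (s := fun i : Fin t.card => ((↑) ⁻¹' O (t.equivFin.symm i).1.1 : Set U))
    (fun i => (hO _ (t.equivFin.symm i).1.2).preimage continuous_subtype_val) hK'
    (fun x hx => by
      obtain ⟨y, hy, hxy⟩ := mem_iUnion₂.1 (ht hx)
      exact mem_iUnion.2 ⟨t.equivFin ⟨y, hy⟩, by simpa using hxy⟩)
  let ψ : Fin t.card → X → ℂ := fun i =>
    Function.extend Subtype.val (fun x : U => (φ i x : ℂ) * f x) 0
  have hψ : ∀ i, ∀ x : U, ψ i x = φ i x * f x := fun i x =>
    Subtype.val_injective.extend_apply _ _ _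
  have hsum : f = ∑ i, ψ i := by
    ext x
    rw [Finset.sum_apply]
    by_cases hx : x ∈ U
    · lift x to U using hx
      simp_rw [hψ, ← Finset.sum_mul]
      by_cases hxK : x.1 ∈ K
      · have := h2 (show x ∈ ((↑) ⁻¹' K : Set U) from hxK)
        simp only [Finset.sum_apply, Pi.one_apply] at this
        rw [← Complex.ofReal_sum, this]
        simp
      · simp [hfK _ hxK]
    · rw [hfK x fun h => hx (hKU h), Finset.sum_eq_zero]
      intro i _
      exact Function.extend_apply' _ _ _ fun ⟨a, ha⟩ => hx (ha ▸ a.2)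
  rw [hsum]
  refine Finset.sum_induction _ P hadd h0 fun i _ => ?_
  refine hOP _ (t.equivFin.symm i).1.2 _ ?_
  have hcf : Continuous fun x : U => (φ i x : ℂ) * f x :=
    (Complex.continuous_ofReal.comp (φ i).continuous).mul hc.domRestrict
  have hE := ccOn_extend (φ := fun x : U => (φ i x : ℂ) * f x) hcf ?_
  · refine ⟨hE.1.mono inter_subset_left, Subtype.val '' tsupport (φ i), ?_,
      (h4 i).isCompact.image continuous_subtype_val, ?_⟩
    · rintro _ ⟨x, hx, rfl⟩
      exact ⟨x.2, h1 i hx⟩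
    · intro x hx
      by_cases hxU : x ∈ U
      · lift x to U using hxU
        rw [hψ, image_eq_zero_of_notMem_tsupport fun h => hx ⟨x, h, rfl⟩]
        simp
      · exact Function.extend_apply' _ _ _ fun ⟨a, ha⟩ => hxU (ha ▸ a.2)
  · refine (h4 i).mono' fun x hx => subset_tsupport _ fun h => hx ?_
    simp [h]

theorem exists_cutoff_ccOn [LocallyCompactSpace X] {B K : Set X} (hB : IsOpen B) [T2Space B]
    (hK : IsCompact K) (hKB : K ⊆ B) :
    ∃ c : X → ℝ, (∀ x, 0 ≤ c x) ∧ (∀ x ∈ K, c x = 1) ∧ CcOn B fun x => (c x : ℂ) := by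
  have := hB.locallyCompactSpace
  have hK' : IsCompact ((↑) ⁻¹' K : Set B) :=
    IsInducing.subtypeVal.isCompact_preimage_iff (by simpa using hKB) |>.2 hK
  obtain ⟨χ, h1, -, h2, h3⟩ := exists_continuous_one_zero_of_isCompact hK' isClosed_empty
    (disjoint_empty _)
  have hval : ∀ x : B, Function.extend Subtype.val (χ : B → ℝ) 0 x.1 = χ x :=
    fun x => Subtype.val_injective.extend_apply _ _ _
  refine ⟨Function.extend Subtype.val χ 0, fun x => ?_, fun x hx => ?_, ?_⟩
  · by_cases hx : x ∈ B
    · rw [hval ⟨x, hx⟩]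
      exact (h3 _).1
    · rw [Function.extend_apply' _ _ _ fun ⟨a, ha⟩ => hx (ha ▸ a.2)]
      rfl
  · rw [hval ⟨x, hKB hx⟩]
    exact h1 hx
  · convert ccOn_extend (φ := fun x : B => (χ x : ℂ)) (by fun_prop) ?_ using 2 with x
    · by_cases hx : x ∈ B
      · rw [hval ⟨x, hx⟩]
        exact (Subtype.val_injective.extend_apply (fun x : B => (χ x : ℂ)) 0 ⟨x, hx⟩).symm
      · rw [Function.extend_apply' _ _ _ fun ⟨a, ha⟩ => hx (ha ▸ a.2),
          Function.extend_apply' _ _ _ fun ⟨a, ha⟩ => hx (ha ▸ a.2)]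
        simp
    · exact h2.comp_left (g := fun r : ℝ => (r : ℂ)) (by simp)

/-- Tietze extension from a closed subset to a Hausdorff open set, with compact supports. -/
theorem exists_ccOn_eqOn [LocallyCompactSpace X] {B A S : Set X} (hB : IsOpen B) [T2Space B]
    (hA : IsClosed A) {u : X → ℂ} (hu : ContinuousOn u A) (hS : IsCompact S) (hSB : S ⊆ B)
    (huS : ∀ x ∈ A, x ∉ S → u x = 0) : ∃ b, CcOn B b ∧ EqOn b u A := by
  have := hB.locallyCompactSpace
  have hS' : IsCompact ((↑) ⁻¹' S : Set B) :=
    IsInducing.subtypeVal.isCompact_preimage_iff (by simpa using hSB) |>.2 hS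
  obtain ⟨χ, h1, -, h2, h3⟩ := exists_continuous_one_zero_of_isCompact hS' isClosed_empty
    (disjoint_empty _)
  let D : Set B := tsupport χ ∩ (↑) ⁻¹' A
  have hD : IsCompact D := h2.isCompact.inter_right (hA.preimage continuous_subtype_val)
  have : CompactSpace D := isCompact_iff_compactSpace.1 hD
  -- The one-point compactification of `B` is compact Hausdorff, hence normal, so Tietze applies to
  -- the compact set `D`. Multiplying by `χ` afterwards restores compact support without changing
  -- values on `S`.
  have he : IsClosedEmbedding fun x : D => ((x : B) : OnePoint B) :=
    Continuous.isClosedEmbedding (OnePoint.continuous_coe.comp continuous_subtype_val)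
      (OnePoint.coe_injective.comp Subtype.val_injective)
  obtain ⟨g, hg⟩ := ContinuousMap.exists_extension he
    (⟨fun x : D => u x.1.1, hu.comp_continuous (by fun_prop) fun x => x.2.2⟩ : C(D, ℂ))
  have hg' : ∀ x : B, x ∈ D → g x = u x := fun x hx => congrArg (fun φ => φ ⟨x, hx⟩) hg
  refine ⟨_, ccOn_extend (φ := fun x : B => (χ x : ℂ) * g x) ?_ ?_, fun x hx => ?_⟩
  · exact (Complex.continuous_ofReal.comp χ.continuous).mul
      (g.continuous.comp OnePoint.continuous_coe)
  · refine h2.mono' fun x hx => subset_tsupport _ fun h => hx ?_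
    simp [h]
  · by_cases hxB : x ∈ B
    · lift x to B using hxB
      rw [Subtype.val_injective.extend_apply]
      by_cases hxS : x.1 ∈ S
      · have e : χ x = 1 := h1 (show x ∈ ((↑) ⁻¹' S : Set B) from hxS)
        rw [hg' x ⟨subset_tsupport _ (by simp [e]), hx⟩, e]
        simp
      · rw [huS x hx hxS]
        by_cases hxD : x ∈ D
        · rw [hg' x hxD, huS x hx hxS, mul_zero]
        · rw [image_eq_zero_of_notMem_tsupport fun h => hxD ⟨h, hx⟩]
          simp
    · rw [Function.extend_apply' _ _ _ fun ⟨a, ha⟩ => hxB (ha ▸ a.2), huS x hx fun h => hxB (hSB h)]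
      rfl

theorem continuous_of_mem_quasiContinuous [T2Space X] {f : X → ℂ}
    (hf : f ∈ quasiContinuous X) : Continuous f := by
  refine quasiContinuous_induction (P := fun f => Continuous f) continuous_const
    (fun f g hf hg => hf.add hg) (fun c f hf => hf.const_smul c) (fun U hU _ f hf => ?_) hf
  obtain ⟨hc, K, hKU, hK, hfK⟩ := hf
  exact continuous_comp_of_isCompact_preimage hU hc hKU hfK continuous_id hK

end CompactSupport

/-! ### Fibres as subspaces -/

section Fibres

variable {X Y : Type*} [TopologicalSpace X] [TopologicalSpace Y] {p : X → Y}

theorem Fib.isInducing (p : X → Y) (y : Y) : IsInducing (Fib.val : Fib p y → X) := ⟨rfl⟩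

theorem Fib.continuous_val (p : X → Y) (y : Y) : Continuous (Fib.val : Fib p y → X) :=
  (Fib.isInducing p y).continuous

theorem Fib.range_val (p : X → Y) (y : Y) : range (Fib.val : Fib p y → X) = p ⁻¹' {y} := by
  ext x
  exact ⟨fun ⟨a, ha⟩ => ha ▸ a.prop, fun h => ⟨⟨x, h⟩, rfl⟩⟩

theorem Fib.isClosedEmbedding [T1Space Y] (hp : Continuous p) (y : Y) :
    IsClosedEmbedding (Fib.val : Fib p y → X) :=
  ⟨⟨Fib.isInducing p y, fun _ _ h => Fib.ext h⟩, by
    rw [Fib.range_val]; exact isClosed_singleton.preimage hp⟩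

theorem Fib.continuous_mk {W : Type*} [TopologicalSpace W] {y : Y} {f : W → X}
    (hf : Continuous f) (h : ∀ w, p (f w) = y) : Continuous fun w => (⟨f w, h w⟩ : Fib p y) :=
  (Fib.isInducing p y).continuous_iff.2 hf

theorem CcOn.comp_fib [T1Space Y] (hp : Continuous p) {y : Y} [T2Space (Fib p y)] {U : Set X}
    (hU : IsOpen U) {f : X → ℂ} (hf : CcOn U f) :
    Continuous (fun x : Fib p y => f x.val) ∧ HasCompactSupport fun x : Fib p y => f x.val := by
  obtain ⟨hc, K, hKU, hK, hfK⟩ := hf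
  have h := (Fib.isClosedEmbedding hp y).isCompact_preimage hK
  exact ⟨continuous_comp_of_isCompact_preimage hU hc hKU hfK (Fib.continuous_val p y) h,
    HasCompactSupport.intro h fun x hx => hfK _ hx⟩

theorem IsContinuousFamily.continuous_integral [T2Space Y] {α : ∀ y, Measure (Fib p y)}
    (hα : IsContinuousFamily p α) {U : Set X} (hU : IsOpen U) [T2Space U] {f : X → ℂ}
    (hf : CcOn U f) : Continuous fun y => ∫ x, f x.val ∂(α y) :=
  continuous_of_mem_quasiContinuous (hα.continuous f (hf.mem_quasiContinuous hU))

end Fibres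

/-! ### Continuity of fibre integrals depending on a parameter -/

section Correspondence

open Filter

variable {X Y Z T : Type*} [TopologicalSpace X] [TopologicalSpace Y] [TopologicalSpace Z]
  [TopologicalSpace T]

/-- A continuous relation `R ⊆ Z × T` whose slice over `z` is identified with the fibre of
`p : X → Y` over `q z`, by `θ z` and its inverse `m z`. -/
structure FibreCorrespondence (p : X → Y) (q : Z → Y) (R : Z → T → Prop) (θ : Z → T → X)
    (m : Z → X → T) : Prop where
  continuous_p : Continuous p
  continuous_q : Continuous q
  right : ∀ z x, p x = q z → R z (m z x) ∧ θ z (m z x) = x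
  left : ∀ z t, R z t → p (θ z t) = q z ∧ m z (θ z t) = t
  tendsto_theta : ∀ z t, R z t →
    Tendsto (fun a : Z × T => θ a.1 a.2) (𝓝 (z, t) ⊓ 𝓟 {a | R a.1 a.2}) (𝓝 (θ z t))
  tendsto_m : ∀ z x, p x = q z →
    Tendsto (fun a : Z × X => m a.1 a.2) (𝓝 (z, x) ⊓ 𝓟 {a | p a.2 = q a.1}) (𝓝 (m z x))
  isClosed : ∀ z, IsClosed {t | R z t}

namespace FibreCorrespondence

variable {p : X → Y} {q : Z → Y} {R : Z → T → Prop} {θ : Z → T → X} {m : Z → X → T}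

theorem continuous_m (h : FibreCorrespondence p q R θ m) (z : Z) :
    Continuous fun x : Fib p (q z) => m z x.val := by
  refine continuous_iff_continuousAt.2 fun x => ?_
  refine (h.tendsto_m z x.val x.prop).comp (tendsto_inf.2 ⟨?_, ?_⟩)
    (f := fun x : Fib p (q z) => (z, x.val))
  · exact (continuous_const.prodMk (Fib.continuous_val p (q z))).tendsto x
  · exact tendsto_principal.2 (.of_forall fun x => x.prop)

theorem continuousOn_theta (h : FibreCorrespondence p q R θ m) (z : Z) :
    ContinuousOn (θ z) {t | R z t} := by
  intro t ht
  refine (h.tendsto_theta z t ht).comp (tendsto_inf.2 ⟨?_, ?_⟩) (f := fun t => (z, t))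
  · exact (Continuous.prodMk_right z).continuousWithinAt
  · exact tendsto_principal.2 self_mem_nhdsWithin

theorem isCompact_image (h : FibreCorrespondence p q R θ m) (z : Z) {K : Set T}
    (hK : IsCompact K) : IsCompact (θ z '' (K ∩ {t | R z t})) :=
  (hK.inter_right (h.isClosed z)).image_of_continuousOn
    ((h.continuousOn_theta z).mono inter_subset_right)

theorem isCompact_preimage [T1Space Y] (h : FibreCorrespondence p q R θ m) (z : Z) {K : Set T}
    (hK : IsCompact K) : IsCompact ((fun x : Fib p (q z) => m z x.val) ⁻¹' K) := by
  convert (Fib.isClosedEmbedding h.continuous_p (q z)).isCompact_preimage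
    (h.isCompact_image z hK) using 1
  ext x
  obtain ⟨h1, h2⟩ := h.right z x.val x.prop
  constructor
  · exact fun hx => ⟨_, ⟨hx, h1⟩, h2⟩
  · rintro ⟨t, ⟨ht, hR⟩, e⟩
    rw [mem_preimage, ← e, (h.left z t hR).2]
    exact ht

theorem continuous_hasCompactSupport [T1Space Y] (h : FibreCorrespondence p q R θ m) (z : Z)
    [T2Space (Fib p (q z))] {U : Set T} (hU : IsOpen U) {f : T → ℂ} (hf : CcOn U f) :
    Continuous (fun x : Fib p (q z) => f (m z x.val)) ∧
      HasCompactSupport fun x : Fib p (q z) => f (m z x.val) := by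
  obtain ⟨hc, K, hKU, hK, hfK⟩ := hf
  exact ⟨continuous_comp_of_isCompact_preimage hU hc hKU hfK (h.continuous_m z)
    (h.isCompact_preimage z hK),
    HasCompactSupport.intro (h.isCompact_preimage z hK) fun x hx => hfK _ hx⟩

theorem _root_.eventually_nhds_prod_of_inf_principal {z : Z} {t : T} {Q P : Z × T → Prop}
    (h : ∀ᶠ a in 𝓝 (z, t) ⊓ 𝓟 {a | Q a}, P a) : ∀ᶠ a in 𝓝 (z, t), Q a → P a := by
  rwa [eventually_inf_principal] at h

/-- Near `z₀`, the function `f (m z ·)` is close to a fixed function on `X`. -/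
theorem eventually_norm_sub_le [T2Space Y] (h : FibreCorrespondence p q R θ m) {z₀ : Z}
    {V : Set T} (hV : IsOpen V) (hsep : ∀ t ∈ V, ¬ R z₀ t → ∀ᶠ a in 𝓝 (z₀, t), ¬ R a.1 a.2)
    {f : T → ℂ} (hf : ContinuousOn f V) {K : Set T} (hKV : K ⊆ V) (hK : IsCompact K)
    (hfK : ∀ t, t ∉ K → f t = 0) {B : Set X} (hB : IsOpen B)
    {b : X → ℂ} (hb : ContinuousOn b B) {D : Set X} (hDB : D ⊆ B) (hD : IsCompact D)
    (hbD : ∀ x, x ∉ D → b x = 0) (hbf : ∀ x, p x = q z₀ → b x = f (m z₀ x))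
    {c : X → ℝ} (hc : ContinuousOn c B) (hc0 : ∀ x, 0 ≤ c x)
    (hcD : ∀ x ∈ D ∪ θ z₀ '' (K ∩ {t | R z₀ t}), c x = 1)
    (hKB : θ z₀ '' (K ∩ {t | R z₀ t}) ⊆ B) {ε : ℝ} (hε : 0 < ε) :
    ∀ᶠ z in 𝓝 z₀, ∀ x, p x = q z → ‖f (m z x) - b x‖ ≤ ε * c x := by
  -- Points with `m z x ∈ K` are treated here in the coordinate `t`; the remaining points of `D` are
  -- treated next in the coordinate `x`. Compactness of `K` and `D` makes each local estimate
  -- uniform.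
  have h1 : ∀ᶠ z in 𝓝 z₀, ∀ t ∈ K, R z t → ‖f t - b (θ z t)‖ ≤ ε * c (θ z t) := by
    refine hK.eventually_forall_of_forall_eventually fun t ht => ?_
    by_cases hR : R z₀ t
    · refine eventually_nhds_prod_of_inf_principal (Q := fun a => R a.1 a.2)
        (P := fun a => ‖f a.2 - b (θ a.1 a.2)‖ ≤ ε * c (θ a.1 a.2)) ?_
      have hmem : θ z₀ t ∈ θ z₀ '' (K ∩ {t | R z₀ t}) := ⟨t, ⟨ht, hR⟩, rfl⟩
      have hθ := h.tendsto_theta z₀ t hR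
      have hθb := ((hb.continuousAt (hB.mem_nhds (hKB hmem))).tendsto.comp hθ)
      have hθc := ((hc.continuousAt (hB.mem_nhds (hKB hmem))).tendsto.comp hθ)
      have hft : Tendsto (fun a : Z × T => f a.2) (𝓝 (z₀, t) ⊓ 𝓟 {a | R a.1 a.2}) (𝓝 (f t)) :=
        ((hf.continuousAt (hV.mem_nhds (hKV ht))).tendsto.comp
          (continuous_snd.tendsto (z₀, t))).mono_left inf_le_left
      refine ((hft.sub hθb).norm.eventually_lt (hθc.const_mul ε) ?_).mono fun a ha => ha.le
      rw [hbf _ (h.left _ _ hR).1, (h.left _ _ hR).2, hcD _ (.inr hmem)]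
      simpa using hε
    · exact (hsep t (hKV ht) hR).mono fun a ha ha' => absurd ha' ha
  have h2 : ∀ᶠ z in 𝓝 z₀, ∀ x ∈ D, p x = q z → m z x ∉ K → ‖b x‖ ≤ ε * c x := by
    refine hD.eventually_forall_of_forall_eventually fun x hx => ?_
    by_cases hpx : p x = q z₀
    · refine eventually_nhds_prod_of_inf_principal (Q := fun a : Z × X => p a.2 = q a.1)
        (P := fun a => m a.1 a.2 ∉ K → ‖b a.2‖ ≤ ε * c a.2) ?_
      have hxb : Tendsto (fun a : Z × X => b a.2) (𝓝 (z₀, x) ⊓ 𝓟 {a | p a.2 = q a.1})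
          (𝓝 (b x)) := ((hb.continuousAt (hB.mem_nhds (hDB hx))).tendsto.comp
          (continuous_snd.tendsto (z₀, x))).mono_left inf_le_left
      have hxc : Tendsto (fun a : Z × X => c a.2) (𝓝 (z₀, x) ⊓ 𝓟 {a | p a.2 = q a.1})
          (𝓝 (c x)) := ((hc.continuousAt (hB.mem_nhds (hDB hx))).tendsto.comp
          (continuous_snd.tendsto (z₀, x))).mono_left inf_le_left
      -- `f` is continuous only on `V`, but `m z₀ x ∉ V` forces `f (m z₀ x) = 0`, hence `b x = 0`,
      -- and continuity of `b` suffices.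
      by_cases hm : m z₀ x ∈ V
      · have hxf := (hf.continuousAt (hV.mem_nhds hm)).tendsto.comp (h.tendsto_m z₀ x hpx)
        refine ((hxf.sub hxb).norm.eventually_lt (hxc.const_mul ε) ?_).mono fun a ha haK => ?_
        · rw [hbf _ hpx, hcD _ (.inl hx)]
          simpa using hε
        · simp only [Function.comp, hfK _ haK, zero_sub, norm_neg] at ha
          exact ha.le
      · refine (hxb.norm.eventually_lt (hxc.const_mul ε) ?_).mono fun a ha haK => ha.le
        rw [hbf _ hpx, hcD _ (.inl hx), hfK _ fun hk => hm (hKV hk)]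
        simpa using hε
    · have : ∀ᶠ a : Z × X in 𝓝 (z₀, x), p a.2 ≠ q a.1 :=
        (isOpen_ne_fun (h.continuous_p.comp continuous_snd)
          (h.continuous_q.comp continuous_fst)).mem_nhds hpx
      exact this.mono fun a ha ha' => absurd ha' ha
  filter_upwards [h1, h2] with z h1 h2 x hx
  obtain ⟨hR, hθ⟩ := h.right z x hx
  by_cases hK' : m z x ∈ K
  · simpa [hθ] using h1 _ hK' hR
  · by_cases hxD : x ∈ D
    · simpa [hfK _ hK'] using h2 x hxD hx hK'
    · simpa [hfK _ hK', hbD _ hxD] using mul_nonneg hε.le (hc0 x)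

/-- Let `b` be a Tietze extension of `f (m z₀ ·)` from the fibre above `q z₀`. Continuity of `∫ b`
is the hypothesis on `α`, and the error is at most a small multiple of `∫ c`, which stays bounded
near `z₀`. The set `B` provides a Hausdorff place for `b` and `c`. -/
theorem continuousAt_integral_of_mem [T2Space Y] [LocallyCompactSpace X]
    (h : FibreCorrespondence p q R θ m) [∀ y, T2Space (Fib p y)]
    {α : ∀ y, Measure (Fib p y)} (hα : IsContinuousFamily p α) {z₀ : Z}
    {V : Set T} (hV : IsOpen V) (hsep : ∀ t ∈ V, ¬ R z₀ t → ∀ᶠ a in 𝓝 (z₀, t), ¬ R a.1 a.2)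
    {B : Set X} (hB : IsOpen B) [T2Space B] (hVB : ∀ t ∈ V, R z₀ t → θ z₀ t ∈ B)
    {f : T → ℂ} (hf : CcOn V f) :
    ContinuousAt (fun z => ∫ x : Fib p (q z), f (m z x.val) ∂(α (q z))) z₀ := by
  have hreg := hα.regular
  obtain ⟨hfc, K, hKV, hK, hfK⟩ := id hf
  have hS := h.isCompact_image z₀ hK
  have hSB : θ z₀ '' (K ∩ {t | R z₀ t}) ⊆ B := by
    rintro _ ⟨t, ⟨ht, hR⟩, rfl⟩
    exact hVB t (hKV ht) hR
  have hA : IsClosed (p ⁻¹' {q z₀}) := isClosed_singleton.preimage h.continuous_p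
  have hu : ContinuousOn (fun x => f (m z₀ x)) (p ⁻¹' {q z₀}) := by
    rw [continuousOn_iff_continuous_domRestrict]
    exact (h.continuous_hasCompactSupport z₀ hV hf).1.comp
      (Fib.continuous_mk continuous_subtype_val fun w : p ⁻¹' {q z₀} => w.2)
  obtain ⟨b, hb, hbf⟩ := exists_ccOn_eqOn hB hA hu hS hSB (fun x hx hxS => hfK _ fun hxK => hxS
    ⟨_, ⟨hxK, (h.right z₀ x hx).1⟩, (h.right z₀ x hx).2⟩)
  obtain ⟨hbc, D, hDB, hD, hbD⟩ := id hb
  obtain ⟨c, hc0, hc1, hc⟩ := exists_cutoff_ccOn hB (hD.union hS) (union_subset hDB hSB)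
  have hcc : ContinuousOn c B := Complex.continuous_re.comp_continuousOn hc.1
  have hIb := hα.continuous_integral hB hb
  have hIc : Continuous fun y => ∫ x : Fib p y, c x.val ∂(α y) := by
    have := Complex.continuous_re.comp (hα.continuous_integral hB hc)
    simpa only [Function.comp_def, integral_complex_ofReal, Complex.ofReal_re] using this
  set J := fun y => ∫ x : Fib p y, c x.val ∂(α y)
  have hJ0 : 0 ≤ J (q z₀) := integral_nonneg fun x => hc0 _
  have hz₀ : ∫ x : Fib p (q z₀), f (m z₀ x.val) ∂(α (q z₀)) = ∫ x, b x.val ∂(α (q z₀)) :=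
    integral_congr_ae (.of_forall fun x => (hbf x.prop).symm)
  rw [ContinuousAt, Metric.tendsto_nhds]
  intro ε hε
  -- Near `z₀` one has `J (q z) < J (q z₀) + 1`, so this factor keeps the error below `ε / 2`.
  have hδ : 0 < ε / (2 * (J (q z₀) + 1)) := by positivity
  filter_upwards [h.eventually_norm_sub_le hV hsep hfc hKV hK hfK hB hbc hDB hD hbD
    (fun x hx => hbf hx) hcc hc0 hc1 hSB hδ,
    ((hIc.comp h.continuous_q).tendsto z₀).eventually (gt_mem_nhds (lt_add_one _)),
    Metric.tendsto_nhds.1 ((hIb.comp h.continuous_q).tendsto z₀) (ε / 2) (half_pos hε)]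
    with z h1 h2 h3
  rw [hz₀]
  have hfi := h.continuous_hasCompactSupport z hV hf
  have hbi := hb.comp_fib h.continuous_p (y := q z) hB
  have hci := hc.comp_fib h.continuous_p (y := q z) hB
  have hci' : Integrable (fun x : Fib p (q z) => c x.val) (α (q z)) := by
    simpa using (hci.1.integrable_of_hasCompactSupport hci.2).re
  have h4 : dist (∫ x : Fib p (q z), f (m z x.val) ∂(α (q z)))
      (∫ x : Fib p (q z), b x.val ∂(α (q z))) ≤ ε / (2 * (J (q z₀) + 1)) * J (q z) := by
    rw [dist_eq_norm, ← integral_sub (hfi.1.integrable_of_hasCompactSupport hfi.2)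
      (hbi.1.integrable_of_hasCompactSupport hbi.2), ← integral_const_mul]
    exact norm_integral_le_of_norm_le (hci'.const_mul _) (.of_forall fun x => h1 _ x.prop)
  have h5 : ε / (2 * (J (q z₀) + 1)) * J (q z) ≤ ε / 2 := by
    calc _ ≤ ε / (2 * (J (q z₀) + 1)) * (J (q z₀) + 1) := by gcongr; exact h2.le
      _ = ε / 2 := by field_simp
  calc _ ≤ _ := dist_triangle _ (∫ x : Fib p (q z), b x.val ∂(α (q z))) _
    _ < ε / 2 + ε / 2 := add_lt_add_of_le_of_lt (h4.trans h5) h3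
    _ = ε := add_halves ε

/-- Integration along the fibres of a correspondence produces continuous functions. -/
theorem continuousAt_integral [T2Space Y] [LocallyCompactSpace X] [LocallyCompactSpace T]
    (h : FibreCorrespondence p q R θ m) (hX : IsLocallyHausdorff X) [∀ y, T2Space (Fib p y)]
    {α : ∀ y, Measure (Fib p y)} (hα : IsContinuousFamily p α) {z₀ : Z}
    {U : Set T} (hU : IsOpen U) [T2Space U]
    (hsep : ∀ t ∈ U, ¬ R z₀ t → ∀ᶠ a in 𝓝 (z₀, t), ¬ R a.1 a.2)
    {f : T → ℂ} (hf : CcOn U f) :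
    ContinuousAt (fun z => ∫ x : Fib p (q z), f (m z x.val) ∂(α (q z))) z₀ := by
  have hreg := hα.regular
  refine (hf.induction_local hU (P := fun f => CcOn U f ∧
    ContinuousAt (fun z => ∫ x : Fib p (q z), f (m z x.val) ∂(α (q z))) z₀) ?_ ?_ ?_).2
  · exact ⟨CcOn.zero U, by simpa using continuousAt_const⟩
  · rintro f g ⟨hf, hf'⟩ ⟨hg, hg'⟩
    refine ⟨hf.add hg, (hf'.add hg').congr (.of_forall fun z => ?_)⟩
    have hfi := h.continuous_hasCompactSupport z hU hf
    have hgi := h.continuous_hasCompactSupport z hU hg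
    exact (integral_add (hfi.1.integrable_of_hasCompactSupport hfi.2)
      (hgi.1.integrable_of_hasCompactSupport hgi.2)).symm
  · intro t ht
    -- For related `t`, the support is shrunk until its image under `θ z₀` lies in a Hausdorff open
    -- set. Otherwise `hsep` makes the integral vanish for all `z` near `z₀`.
    by_cases hR : R z₀ t
    · obtain ⟨B, hB, htB, hB2⟩ := hX (θ z₀ t)
      have := (h.continuousOn_theta z₀ t hR).eventually (hB.mem_nhds htB)
      obtain ⟨O, hO, hOo, htO⟩ := eventually_nhds_iff.1 (eventually_nhdsWithin_iff.1 this)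
      refine ⟨O, hOo, htO, fun g hg => ⟨hg.mono (hU.inter hOo) inter_subset_left, ?_⟩⟩
      exact h.continuousAt_integral_of_mem hα (hU.inter hOo) (fun t ht => hsep t ht.1) hB
        (fun t ht hR => hO t ht.2 hR) hg
    · have := hsep t ht hR
      rw [nhds_prod_eq] at this
      obtain ⟨N, hN, O, hO, hNO⟩ := eventually_prod_iff.1 this
      obtain ⟨O', hO', hOo, htO⟩ := eventually_nhds_iff.1 hO
      refine ⟨O', hOo, htO, fun g hg => ⟨hg.mono (hU.inter hOo) inter_subset_left, ?_⟩⟩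
      refine (continuousAt_const (y := (0 : ℂ))).congr ?_
      filter_upwards [hN] with z hz
      obtain ⟨-, K, hK, -, hgK⟩ := hg
      refine (integral_eq_zero_of_ae (.of_forall fun x => hgK _ fun hx => ?_)).symm
      exact hNO hz (hO' _ (hK hx).2) (h.right z x.val x.prop).1

end FibreCorrespondence

end Correspondence

/-! ### Locally Hausdorff spaces -/

section LocallyHausdorff

open Filter

variable {X W : Type*} [TopologicalSpace X] [TopologicalSpace W]

theorem tendsto_nhds_unique_of_isOpen {ι : Type*} {l : Filter ι} [l.NeBot] {B : Set X}
    (hB : IsOpen B) [T2Space B] {f : ι → X} {a b : X} (ha : Tendsto f l (𝓝 a))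
    (hb : Tendsto f l (𝓝 b)) (haB : a ∈ B) (hbB : b ∈ B) : a = b := by
  by_contra hab
  lift a to B using haB
  lift b to B using hbB
  have h : Disjoint (𝓝 a) (𝓝 b) := disjoint_nhds_nhds.2 fun h => hab (congrArg _ h)
  have h' := (disjoint_map (m := ((↑) : B → X)) Subtype.val_injective).2 h
  rw [hB.isOpenEmbedding_subtypeVal.map_nhds_eq, hB.isOpenEmbedding_subtypeVal.map_nhds_eq] at h'
  exact (ha.not_tendsto h') hb

theorem IsLocallyHausdorff.t1Space (h : IsLocallyHausdorff X) : T1Space X := by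
  refine t1Space_iff_exists_open.2 fun x y hxy => ?_
  obtain ⟨U, hU, hx, hU2⟩ := h x
  by_cases hy : y ∈ U
  · lift x to U using hx
    lift y to U using hy
    obtain ⟨V, hV, hxV, hyV⟩ := t1Space_iff_exists_open.1 (inferInstance : T1Space U)
      (show x ≠ y from fun e => hxy (congrArg _ e))
    exact ⟨_, hU.isOpenMap_subtype_val V hV, ⟨x, hxV, rfl⟩, fun ⟨z, hz, e⟩ =>
      hyV (Subtype.ext e ▸ hz)⟩
  · exact ⟨U, hU, hx, hy⟩

theorem IsLocallyHausdorff.of_injective (h : IsLocallyHausdorff X) {j : W → X}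
    (hj : Continuous j) (hinj : Function.Injective j) : IsLocallyHausdorff W := by
  intro w
  obtain ⟨U, hU, hw, hU2⟩ := h (j w)
  exact ⟨j ⁻¹' U, hU.preimage hj, hw, T2Space.of_injective_continuous
    (f := fun x : j ⁻¹' U => (⟨j x, x.2⟩ : U)) (fun a b e => Subtype.ext (hinj (congrArg (·.1) e)))
    (by fun_prop)⟩

theorem IsLocallyHausdorff.prod (h : IsLocallyHausdorff X) [T2Space W] :
    IsLocallyHausdorff (X × W) := by
  intro w
  obtain ⟨U, hU, hw, hU2⟩ := h w.1
  exact ⟨Prod.fst ⁻¹' U, hU.preimage continuous_fst, hw, T2Space.of_injective_continuous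
    (f := fun x : Prod.fst ⁻¹' U => ((⟨x.1.1, x.2⟩, x.1.2) : U × W))
    (fun a b e => Subtype.ext (Prod.ext (congrArg (·.1.1) e) (congrArg (·.2) e)))
    (by fun_prop)⟩

end LocallyHausdorff

/-! ### Totalised multiplication and Hausdorff range fibres -/

namespace TopGroupoid

open Filter

variable {X : Type*} {A : Type*} [TopologicalSpace X] [TopologicalSpace A] (G : TopGroupoid X A)

open Classical in
/-- The product of two arrows, with a junk value when it is not defined. -/
noncomputable def tmul (a b : A) : A := if h : G.s a = G.r b then G.mul a b h else a

theorem tmul_eq {a b : A} (h : G.s a = G.r b) : G.tmul a b = G.mul a b h := dif_pos h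

theorem r_tmul (a b : A) : G.r (G.tmul a b) = G.r a := by
  unfold tmul
  split_ifs with h
  · exact G.r_mul a b h
  · rfl

theorem s_tmul {a b : A} (h : G.s a = G.r b) : G.s (G.tmul a b) = G.s b := by
  rw [G.tmul_eq h, G.s_mul]

theorem tmul_assoc {a b c : A} (h : G.s a = G.r b) (h' : G.s b = G.r c) :
    G.tmul (G.tmul a b) c = G.tmul a (G.tmul b c) := by
  rw [G.tmul_eq ((G.s_tmul h).trans h'), G.tmul_eq (h.trans (G.r_tmul b c).symm)]
  simp only [G.tmul_eq h, G.tmul_eq h']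
  exact G.mul_assoc a b c h h'

theorem unit_tmul {x : X} {a : A} (h : G.r a = x) : G.tmul (G.unit x) a = a := by
  subst h
  rw [G.tmul_eq (G.s_unit _), G.unit_mul]

theorem tmul_unit {x : X} {a : A} (h : G.s a = x) : G.tmul a (G.unit x) = a := by
  subst h
  rw [G.tmul_eq (G.r_unit _).symm, G.mul_unit]

theorem inv_tmul (a : A) : G.tmul (G.inv a) a = G.unit (G.s a) := by
  rw [G.tmul_eq (G.s_inv a), G.inv_mul]

theorem tmul_inv (a : A) : G.tmul a (G.inv a) = G.unit (G.r a) := by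
  rw [G.tmul_eq (G.r_inv a).symm, G.mul_inv]

theorem inv_tmul_cancel {a b : A} (h : G.s a = G.r b) :
    G.tmul (G.inv a) (G.tmul a b) = b := by
  rw [← G.tmul_assoc (G.s_inv a) h, G.inv_tmul, G.unit_tmul h.symm]

theorem tmul_inv_cancel {a b : A} (h : G.r a = G.r b) :
    G.tmul a (G.tmul (G.inv a) b) = b := by
  rw [← G.tmul_assoc (G.r_inv a).symm ((G.s_inv a).trans h), G.tmul_inv, G.unit_tmul h.symm]

theorem tmul_tmul_inv_cancel {a b : A} (h : G.s a = G.s b) :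
    G.tmul (G.tmul a (G.inv b)) b = a := by
  rw [G.tmul_assoc (h.trans (G.r_inv b).symm) (G.s_inv b), G.inv_tmul, G.tmul_unit h]

theorem eq_inv_of_tmul_eq_unit {a b : A} (h : G.s b = G.r a)
    (hab : G.tmul b a = G.unit (G.s a)) : b = G.inv a := by
  have := congrArg (fun c => G.tmul c (G.inv a)) hab
  simp only [G.tmul_assoc h (G.r_inv a).symm, G.tmul_inv] at this
  rwa [G.tmul_unit h, G.unit_tmul (G.r_inv a)] at this

theorem tendsto_tmul {ι : Type*} {l : Filter ι} {u v : ι → A} {a b : A}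
    (hu : Tendsto u l (𝓝 a)) (hv : Tendsto v l (𝓝 b)) (h : ∀ᶠ i in l, G.s (u i) = G.r (v i))
    (hab : G.s a = G.r b) : Tendsto (fun i => G.tmul (u i) (v i)) l (𝓝 (G.tmul a b)) := by
  have h1 : ContinuousOn (fun p : A × A => G.tmul p.1 p.2) {p | G.s p.1 = G.r p.2} := by
    rw [continuousOn_iff_continuous_domRestrict]
    exact G.continuous_mul.congr fun p => (G.tmul_eq p.2).symm
  exact (h1 (a, b) hab).tendsto.comp (tendsto_nhdsWithin_iff.2 ⟨hu.prodMk_nhds hv, h⟩)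

/-- The range fibres of a locally Hausdorff groupoid over a Hausdorff space are Hausdorff. -/
theorem t2Space_fib_r [T2Space X] [T1Space A] (x : X) : T2Space (Fib G.r x) := by
  refine t2_iff_nhds.2 fun {g h} hgh => ?_
  have hg : Tendsto Fib.val (𝓝 g ⊓ 𝓝 h) (𝓝 g.val) :=
    ((Fib.continuous_val G.r x).tendsto g).mono_left inf_le_left
  have hh : Tendsto Fib.val (𝓝 g ⊓ 𝓝 h) (𝓝 h.val) :=
    ((Fib.continuous_val G.r x).tendsto h).mono_left inf_le_right
  have hs : G.s g.val = G.s h.val := tendsto_nhds_unique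
    ((G.continuous_s.tendsto _).comp hg) ((G.continuous_s.tendsto _).comp hh)
  -- If one filter in the fibre converges to both `g` and `h`, then `i i⁻¹`, constantly `1_x`,
  -- converges to `g h⁻¹`. In a `T1` space a constant has only one limit, so `g = h`.
  have h1 := G.tendsto_tmul hg ((G.continuous_inv.tendsto _).comp hh)
    (.of_forall fun i => (G.r_inv _).symm) (hs.trans (G.r_inv _).symm)
  have h2 : (fun i : Fib G.r x => G.tmul i.val ((G.inv ∘ Fib.val) i)) = fun _ => G.unit x := by
    ext i
    rw [Function.comp, G.tmul_inv, i.prop]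
  rw [h2, tendsto_const_nhds_iff] at h1
  have h3 := G.tmul_tmul_inv_cancel hs
  rw [← h1, G.unit_tmul h.prop] at h3
  exact Fib.ext h3.symm

end TopGroupoid

/-! ### Division in the total groupoid and the topology of its arrow space -/

namespace GroupoidFibration

open Filter

variable {L0 L1 H0 H1 : Type*} [TopologicalSpace L0] [TopologicalSpace L1]
  [TopologicalSpace H0] [TopologicalSpace H1] {L : TopGroupoid L0 L1} {H : TopGroupoid H0 H1}
  (F : GroupoidFibration L H)

theorem arr_tmul {a b : L1} (h : L.s a = L.r b) :
    F.arr (L.tmul a b) = H.tmul (F.arr a) (F.arr b) := by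
  rw [L.tmul_eq h, F.arr_mul, H.tmul_eq]

theorem arr_inv (a : L1) : F.arr (L.inv a) = H.inv (F.arr a) := by
  refine H.eq_inv_of_tmul_eq_unit (by rw [F.s_arr, L.s_inv, F.r_arr]) ?_
  rw [← F.arr_tmul (L.s_inv a), L.inv_tmul, F.arr_unit, F.s_arr]

theorem arr_tmul_fibre {k : L1} (g : F.FibreArrow) : F.arr (L.tmul k g.1) = F.arr k := by
  by_cases h : L.s k = L.r g.1
  · rw [L.tmul_eq h, F.arr_mul_fibre]
  · rw [TopGroupoid.tmul, dif_neg h]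

theorem arrRange_tmul_fibre {k : L1} (g : F.FibreArrow) :
    F.arrRange (L.tmul k g.1) = F.arrRange k :=
  Subtype.ext (Prod.ext (F.arr_tmul_fibre g) (L.r_tmul _ _))

theorem arrRange_eq_iff {k l : L1} :
    F.arrRange k = F.arrRange l ↔ F.arr k = F.arr l ∧ L.r k = L.r l := by
  simp [arrRange]

theorem continuous_arrRange : Continuous F.arrRange :=
  (F.continuous_arr.prodMk L.continuous_r).subtype_mk _

theorem surjective_arrRange : Function.Surjective F.arrRange := by
  rintro ⟨⟨h, x⟩, hx⟩
  obtain ⟨l, hl⟩ := F.surjective_arr_s ⟨(H.inv h, x), (H.s_inv h).trans hx⟩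
  have e1 : F.arr l = H.inv h := congrArg (fun p => p.1.1) hl
  have e2 : L.s l = x := congrArg (fun p => p.1.2) hl
  exact ⟨L.inv l, Subtype.ext (Prod.ext ((F.arr_inv l).trans (by rw [e1, H.inv_inv]))
    ((L.r_inv l).trans e2))⟩

/-- Inversion exchanges `r` and `s`, which turns the fibration axiom for `(F¹, s)` into one for
`(F¹, r)`. -/
theorem isOpenMap_arrRange : IsOpenMap F.arrRange := by
  intro O hO
  have hc : Continuous fun p : F.RangePullback =>
      (⟨(H.inv p.1.1, p.1.2), (H.s_inv _).trans p.2⟩ : {p : H1 × L0 // H.s p.1 = F.obj p.2}) :=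
    ((H.continuous_inv.comp (continuous_fst.comp continuous_subtype_val)).prodMk
      (continuous_snd.comp continuous_subtype_val)).subtype_mk _
  convert (F.isOpenMap_arr_s _ (hO.preimage L.continuous_inv)).preimage hc using 1
  ext p
  constructor
  · rintro ⟨l, hl, rfl⟩
    refine ⟨L.inv l, by rwa [mem_preimage, L.inv_inv], ?_⟩
    exact Subtype.ext (Prod.ext (F.arr_inv l) (L.s_inv l))
  · rintro ⟨l, hl, e⟩
    have e1 : F.arr l = H.inv p.1.1 := congrArg (fun p => p.1.1) e
    have e2 : L.s l = p.1.2 := congrArg (fun p => p.1.2) e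
    exact ⟨L.inv l, hl, Subtype.ext (Prod.ext ((F.arr_inv l).trans (by rw [e1, H.inv_inv]))
      ((L.r_inv l).trans e2))⟩

theorem div_mem_fibre {k l : L1} (h : F.arrRange k = F.arrRange l) :
    F.arr (L.tmul (L.inv k) l) = H.unit (F.obj (L.s (L.tmul (L.inv k) l))) := by
  obtain ⟨h1, h2⟩ := F.arrRange_eq_iff.1 h
  rw [F.arr_tmul ((L.s_inv k).trans h2), L.s_tmul ((L.s_inv k).trans h2), F.arr_inv, h1,
    H.inv_tmul, F.s_arr]

open Classical in
/-- The quotient `k⁻¹ l ∈ G` of two arrows with the same image under `(F¹, r)`. -/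
noncomputable def div (k l : L1) : F.FibreArrow :=
  if h : F.arrRange k = F.arrRange l then ⟨L.tmul (L.inv k) l, F.div_mem_fibre h⟩
  else ⟨L.unit (L.s k), F.unit_mem_fibre _⟩

theorem div_val {k l : L1} (h : F.arrRange k = F.arrRange l) :
    (F.div k l).1 = L.tmul (L.inv k) l := by
  rw [div, dif_pos h]

theorem r_div (k l : L1) : L.r (F.div k l).1 = L.s k := by
  by_cases h : F.arrRange k = F.arrRange l
  · rw [F.div_val h, L.r_tmul, L.r_inv]
  · rw [div, dif_neg h, L.r_unit]

theorem s_div {k l : L1} (h : F.arrRange k = F.arrRange l) : L.s (F.div k l).1 = L.s l := by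
  rw [F.div_val h, L.s_tmul ((L.s_inv k).trans (F.arrRange_eq_iff.1 h).2)]

theorem tmul_div {k l : L1} (h : F.arrRange k = F.arrRange l) : L.tmul k (F.div k l).1 = l := by
  rw [F.div_val h, L.tmul_inv_cancel (F.arrRange_eq_iff.1 h).2]

theorem div_tmul {k : L1} {g : F.FibreArrow} (h : L.s k = L.r g.1) :
    F.div k (L.tmul k g.1) = g :=
  Subtype.ext (by rw [F.div_val (F.arrRange_tmul_fibre g).symm, L.inv_tmul_cancel h])

theorem div_self (k : L1) : F.div k k = F.fibre.unit (L.s k) :=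
  Subtype.ext (by rw [F.div_val rfl, L.inv_tmul]; rfl)

theorem fibre_tmul_val {a b : F.FibreArrow} (h : L.s a.1 = L.r b.1) :
    (F.fibre.tmul a b).1 = L.tmul a.1 b.1 := by
  rw [F.fibre.tmul_eq h, L.tmul_eq h]
  rfl

theorem div_tmul_div {k l m : L1} (h : F.arrRange k = F.arrRange l)
    (h' : F.arrRange l = F.arrRange m) : F.fibre.tmul (F.div k l) (F.div l m) = F.div k m := by
  have e : L.s (F.div k l).1 = L.r (F.div l m).1 := by rw [F.s_div h, F.r_div]
  have e1 : L.tmul k (F.fibre.tmul (F.div k l) (F.div l m)).1 = m := by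
    rw [F.fibre_tmul_val e, ← L.tmul_assoc (F.r_div k l).symm e, F.tmul_div h, F.tmul_div h']
  have e2 := F.div_tmul (k := k) (g := F.fibre.tmul (F.div k l) (F.div l m))
    (by rw [F.fibre_tmul_val e, L.r_tmul, F.r_div])
  rw [← e2, e1]

theorem eq_of_div_eq_unit {k l : L1} (h : F.arrRange k = F.arrRange l)
    (he : F.div k l = F.fibre.unit (L.s k)) : k = l := by
  have := F.tmul_div h
  rw [he] at this
  rw [← this]
  exact (L.tmul_unit rfl).symm

theorem tendsto_div {ι : Type*} {f : Filter ι} {u v : ι → L1} {a b : L1}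
    (hu : Tendsto u f (𝓝 a)) (hv : Tendsto v f (𝓝 b))
    (h : ∀ᶠ i in f, F.arrRange (u i) = F.arrRange (v i)) (hab : F.arrRange a = F.arrRange b) :
    Tendsto (fun i => F.div (u i) (v i)) f (𝓝 (F.div a b)) := by
  rw [tendsto_subtype_rng, F.div_val hab]
  refine (L.tendsto_tmul ((L.continuous_inv.tendsto a).comp hu) hv ?_
    ((L.s_inv a).trans (F.arrRange_eq_iff.1 hab).2)).congr' ?_
  · exact h.mono fun i hi => (L.s_inv _).trans (F.arrRange_eq_iff.1 hi).2
  · exact h.mono fun i hi => (F.div_val hi).symm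

theorem isLocallyHausdorff_rangePullback [T2Space L0] (hH : IsLocallyHausdorff H1) :
    IsLocallyHausdorff F.RangePullback :=
  hH.prod.of_injective continuous_subtype_val Subtype.val_injective

theorem locallyCompactSpace_rangePullback [T2Space H0] [LocallyCompactSpace L0]
    [LocallyCompactSpace H1] : LocallyCompactSpace F.RangePullback := by
  have : IsClosed {p : H1 × L0 | H.r p.1 = F.obj p.2} :=
    isClosed_eq (H.continuous_r.comp continuous_fst) (F.continuous_obj.comp continuous_snd)
  exact this.isClosedEmbedding_subtypeVal.locallyCompactSpace

theorem exists_nhds_div_mem (l₀ : L1) {D : Set F.FibreArrow}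
    (hD : D ∈ 𝓝 (F.fibre.unit (L.s l₀))) :
    ∃ N, IsOpen N ∧ l₀ ∈ N ∧ ∀ k ∈ N, ∀ l ∈ N, F.arrRange k = F.arrRange l → F.div k l ∈ D := by
  have h : Tendsto (fun a : L1 × L1 => F.div a.1 a.2)
      (𝓝 (l₀, l₀) ⊓ 𝓟 {a | F.arrRange a.1 = F.arrRange a.2}) (𝓝 (F.div l₀ l₀)) :=
    F.tendsto_div ((continuous_fst.tendsto (l₀, l₀)).mono_left inf_le_left)
      ((continuous_snd.tendsto (l₀, l₀)).mono_left inf_le_left)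
      (mem_inf_of_right (mem_principal_self _)) rfl
  rw [F.div_self] at h
  have h' := eventually_inf_principal.1 (h.eventually hD)
  rw [nhds_prod_eq] at h'
  obtain ⟨t, ht, hP⟩ := mem_prod_self_iff.1 h'
  obtain ⟨N, hNt, hN, hl⟩ := mem_nhds_iff.1 ht
  exact ⟨N, hN, hl, fun k hk l hl e => hP (mk_mem_prod (hNt hk) (hNt hl)) e⟩

/-- The arrow space of the total groupoid of a fibration is locally Hausdorff. -/
theorem isLocallyHausdorff_arrows [T2Space L0] (hG : IsLocallyHausdorff F.FibreArrow)
    (hH : IsLocallyHausdorff H1) : IsLocallyHausdorff L1 := by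
  intro l₀
  obtain ⟨B, hB, hBe, hB2⟩ := hG (F.fibre.unit (L.s l₀))
  obtain ⟨V, hV, hVe, hV2⟩ := F.isLocallyHausdorff_rangePullback hH (F.arrRange l₀)
  obtain ⟨N, hN, hl₀, hdiv⟩ := F.exists_nhds_div_mem l₀ (hB.mem_nhds hBe)
  refine ⟨N ∩ F.arrRange ⁻¹' V, hN.inter (hV.preimage F.continuous_arrRange), ⟨hl₀, hVe⟩, ?_⟩
  refine t2_iff_nhds.2 fun {k l} hkl => Subtype.ext ?_
  have hk : Tendsto Subtype.val (𝓝 k ⊓ 𝓝 l) (𝓝 k.1) :=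
    (continuous_subtype_val.tendsto k).mono_left inf_le_left
  have hl : Tendsto Subtype.val (𝓝 k ⊓ 𝓝 l) (𝓝 l.1) :=
    (continuous_subtype_val.tendsto l).mono_left inf_le_right
  have hR : F.arrRange k = F.arrRange l := tendsto_nhds_unique_of_isOpen hV
    ((F.continuous_arrRange.tendsto _).comp hk) ((F.continuous_arrRange.tendsto _).comp hl)
    k.2.2 l.2.2
  -- The quotients `i⁻¹ i` tend both to `k⁻¹ l` and to `k⁻¹ k`; both limits lie in the Hausdorff set
  -- `B`, so they agree.
  refine F.eq_of_div_eq_unit hR ?_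
  rw [← F.div_self]
  exact tendsto_nhds_unique_of_isOpen hB (F.tendsto_div hk hl (.of_forall fun _ => rfl) hR)
    (F.tendsto_div hk hk (.of_forall fun _ => rfl) rfl) (hdiv _ k.2.1 _ l.2.1 hR)
    (hdiv _ k.2.1 _ k.2.1 rfl)

/-- Openness of `(F¹, r)` lets a limit downstairs be lifted: arrows near `k` can be paired with
arrows of `f` having the same image, so that their quotients can be studied. -/
theorem exists_lift_ultrafilter {f : Filter L1} [f.NeBot] {k : L1}
    (h : Tendsto F.arrRange f (𝓝 (F.arrRange k))) : ∃ w : Ultrafilter (L1 × L1),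
      Tendsto Prod.fst (w : Filter (L1 × L1)) (𝓝 k) ∧ Tendsto Prod.snd (w : Filter (L1 × L1)) f ∧
        ∀ᶠ a in (w : Filter (L1 × L1)), F.arrRange a.1 = F.arrRange a.2 := by
  have : ((𝓝 k ×ˢ f) ⊓ 𝓟 {a : L1 × L1 | F.arrRange a.1 = F.arrRange a.2}).NeBot := by
    refine inf_principal_neBot_iff.2 fun s hs => ?_
    obtain ⟨t, ht, u, hu, htu⟩ := mem_prod_iff.1 hs
    have hm : F.arrRange ⁻¹' (F.arrRange '' t) ∈ f := h (F.isOpenMap_arrRange.image_mem_nhds ht)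
    obtain ⟨l, ⟨k', hk', e⟩, hl⟩ := Filter.nonempty_of_mem (inter_mem hm hu)
    exact ⟨(k', l), htu ⟨hk', hl⟩, e⟩
  let w := Ultrafilter.of ((𝓝 k ×ˢ f) ⊓ 𝓟 {a : L1 × L1 | F.arrRange a.1 = F.arrRange a.2})
  have hw := Ultrafilter.of_le
    ((𝓝 k ×ˢ f) ⊓ 𝓟 {a : L1 × L1 | F.arrRange a.1 = F.arrRange a.2})
  exact ⟨w, tendsto_fst.mono_left (hw.trans inf_le_left),
    tendsto_snd.mono_left (hw.trans inf_le_left), hw (mem_inf_of_right (mem_principal_self _))⟩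

/-- The arrow space of the total groupoid of a fibration is locally compact. -/
theorem locallyCompactSpace_arrows [T2Space L0] [LocallyCompactSpace L0] [T2Space H0]
    (hG : IsLocallyHausdorff F.FibreArrow) [LocallyCompactSpace F.FibreArrow]
    [LocallyCompactSpace H1] : LocallyCompactSpace L1 := by
  have := F.locallyCompactSpace_rangePullback
  refine ⟨fun l₀ N hN => ?_⟩
  set e := F.fibre.unit (L.s l₀) with he
  obtain ⟨B, hB, hBe, hB2⟩ := hG e
  have hee : F.fibre.s e = F.fibre.r e := (F.fibre.s_unit _).trans (F.fibre.r_unit _).symm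
  obtain ⟨N₁, hN₁, D₁, hD₁, hND⟩ : ∃ N₁ ∈ 𝓝 l₀, ∃ D₁ ∈ 𝓝 e, ∀ k ∈ N₁, ∀ d ∈ D₁,
      L.s k = L.r d.1 → L.tmul k d.1 ∈ N := by
    have h : Tendsto (fun a : L1 × F.FibreArrow => L.tmul a.1 a.2.1)
        (𝓝 (l₀, e) ⊓ 𝓟 {a | L.s a.1 = L.r a.2.1}) (𝓝 (L.tmul l₀ e.1)) :=
      L.tendsto_tmul ((continuous_fst.tendsto (l₀, e)).mono_left inf_le_left)
        (((continuous_subtype_val.comp continuous_snd).tendsto (l₀, e)).mono_left inf_le_left)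
        (mem_inf_of_right (mem_principal_self _)) (L.r_unit _).symm
    have e1 : L.tmul l₀ e.1 = l₀ := L.tmul_unit rfl
    rw [e1] at h
    have h' := eventually_inf_principal.1 (h.eventually hN)
    rw [nhds_prod_eq] at h'
    obtain ⟨t, ht, u, hu, htu⟩ := mem_prod_iff.1 h'
    exact ⟨t, ht, u, hu, fun k hk d hd h => htu (mk_mem_prod hk hd) h⟩
  obtain ⟨D₂, hD₂, hDD⟩ : ∃ D₂ ∈ 𝓝 e, ∀ a ∈ D₂, ∀ b ∈ D₂,
      L.s a.1 = L.r b.1 → F.fibre.tmul a b ∈ B := by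
    have h : Tendsto (fun a : F.FibreArrow × F.FibreArrow => F.fibre.tmul a.1 a.2)
        (𝓝 (e, e) ⊓ 𝓟 {a | L.s a.1.1 = L.r a.2.1}) (𝓝 (F.fibre.tmul e e)) :=
      F.fibre.tendsto_tmul ((continuous_fst.tendsto (e, e)).mono_left inf_le_left)
        ((continuous_snd.tendsto (e, e)).mono_left inf_le_left)
        (mem_inf_of_right (mem_principal_self _)) hee
    rw [F.fibre.unit_tmul (F.fibre.r_unit _)] at h
    have h' := eventually_inf_principal.1 (h.eventually (hB.mem_nhds hBe))
    rw [nhds_prod_eq] at h'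
    obtain ⟨t, ht, hP⟩ := mem_prod_self_iff.1 h'
    exact ⟨t, ht, fun a ha b hb h => hP (mk_mem_prod ha hb) h⟩
  obtain ⟨D, hD, hDsub, hDc⟩ := LocallyCompactSpace.local_compact_nhds e _
    (inter_mem hD₁ (inter_mem hD₂ (hB.mem_nhds hBe)))
  obtain ⟨N₂, hN₂, hl₂, hdiv⟩ := F.exists_nhds_div_mem l₀ hD
  obtain ⟨U', hU', hU'o, hl₁⟩ := mem_nhds_iff.1 hN₁
  obtain ⟨U, hUdef⟩ : ∃ U, U = U' ∩ N₂ := ⟨_, rfl⟩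
  have hU : IsOpen U := hUdef ▸ hU'o.inter hN₂
  have hl₀ : l₀ ∈ U := hUdef ▸ ⟨hl₁, hl₂⟩
  have hUN₁ : U ⊆ N₁ := hUdef ▸ inter_subset_left.trans hU'
  have hUN₂ : U ⊆ N₂ := hUdef ▸ inter_subset_right
  obtain ⟨C, hC, hCU, hCc⟩ := LocallyCompactSpace.local_compact_nhds (F.arrRange l₀) _
    (F.isOpenMap_arrRange.image_mem_nhds (hU.mem_nhds hl₀))
  -- Quantifying over all `k ∈ U` makes this a neighbourhood by the choice of `N₂`. Since `C` lies
  -- in the image of `U`, each member is `k d` with `k ∈ U` and `d ∈ D`, hence lies in `N`.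
  refine ⟨{l | F.arrRange l ∈ C ∧ ∀ k ∈ U, F.arrRange k = F.arrRange l → F.div k l ∈ D},
    ?_, ?_, ?_⟩
  · filter_upwards [hU.mem_nhds hl₀, F.continuous_arrRange.continuousAt.preimage_mem_nhds hC]
      with l hl hlC
    exact ⟨hlC, fun k hk h => hdiv k (hUN₂ hk) l (hUN₂ hl) h⟩
  · rintro l ⟨hlC, hl⟩
    obtain ⟨k, hk, h⟩ := hCU hlC
    rw [← F.tmul_div h]
    exact hND k (hUN₁ hk) _ (hDsub (hl k hk h)).1 (F.r_div k l).symm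
  · refine isCompact_iff_ultrafilter_le_nhds.2 fun f hf => ?_
    rw [le_principal_iff] at hf
    obtain ⟨p, hpC, hp⟩ := isCompact_iff_ultrafilter_le_nhds.1 hCc (f.map F.arrRange)
      (le_principal_iff.2 (show F.arrRange ⁻¹' C ∈ f from mem_of_superset hf fun l hl => hl.1))
    obtain ⟨k, hk, rfl⟩ := hCU hpC
    -- Along the lift, the first components tend to `k` and the quotients to some `g ∈ D`, so the
    -- second components tend to `k g`. Thus `k g` is a cluster point of the ultrafilter `f`, hence
    -- a limit.
    obtain ⟨w, hw1, hw2, hwR⟩ := F.exists_lift_ultrafilter (f := f) hp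
    have hwD : ∀ᶠ a in (w : Filter (L1 × L1)), F.div a.1 a.2 ∈ D := by
      filter_upwards [hw1 (hU.mem_nhds hk), hw2 hf, hwR] with a h1 h2 h3 using h2.2 a.1 h1 h3
    obtain ⟨g, hgD, hg⟩ := isCompact_iff_ultrafilter_le_nhds.1 hDc
      (w.map fun a : L1 × L1 => F.div a.1 a.2) (le_principal_iff.2 (Ultrafilter.mem_map.2 hwD))
    have hg : Tendsto (fun a : L1 × L1 => F.div a.1 a.2) w (𝓝 g) := hg
    have hrg : L.s k = L.r g.1 := by
      have h1 := ((L.continuous_r.comp continuous_subtype_val).tendsto g).comp hg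
      have h2 := (L.continuous_s.tendsto k).comp hw1
      exact tendsto_nhds_unique h2 (h1.congr fun a => F.r_div _ _)
    have hlim : Tendsto Prod.snd (w : Filter (L1 × L1)) (𝓝 (L.tmul k g.1)) :=
      (L.tendsto_tmul hw1 ((continuous_subtype_val.tendsto g).comp hg)
        (.of_forall fun a => (F.r_div _ _).symm) hrg).congr' (hwR.mono fun a ha => F.tmul_div ha)
    have hfl : (f : Filter L1) ≤ 𝓝 (L.tmul k g.1) := by
      rw [← Ultrafilter.clusterPt_iff]
      exact (map_neBot (f := (w : Filter (L1 × L1))) (m := Prod.snd)).mono (le_inf hlim hw2)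
    refine ⟨L.tmul k g.1, ⟨by rwa [F.arrRange_tmul_fibre], fun k₂ hk₂ hR => ?_⟩, hfl⟩
    have hR' := hR.trans (F.arrRange_tmul_fibre g)
    obtain ⟨v, hv1, hv2, hvR⟩ := F.exists_lift_ultrafilter (f := f) (k := k₂) (by rwa [hR'])
    have hvD : ∀ᶠ a in (v : Filter (L1 × L1)), F.div a.1 a.2 ∈ D := by
      filter_upwards [hv1 (hU.mem_nhds hk₂), hv2 hf, hvR] with a h1 h2 h3 using h2.2 a.1 h1 h3
    obtain ⟨d, hdD, hd⟩ := isCompact_iff_ultrafilter_le_nhds.1 hDc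
      (v.map fun a : L1 × L1 => F.div a.1 a.2) (le_principal_iff.2 (Ultrafilter.mem_map.2 hvD))
    have hdiv₂ := F.tendsto_div hv1 (hv2.mono_right hfl) hvR hR
    -- The compact set `D` need not be closed in `G`. Membership of the limit in `D` follows from
    -- uniqueness of limits in `B`, which contains it because it is a product of two elements of
    -- `D₂`.
    have hB' : F.div k₂ (L.tmul k g.1) ∈ B := by
      rw [← F.div_tmul_div hR' (F.arrRange_tmul_fibre g).symm, F.div_tmul hrg]
      exact hDD _ (hDsub (hdiv k₂ (hUN₂ hk₂) k (hUN₂ hk) hR')).2.1 _ (hDsub hgD).2.1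
        ((F.s_div hR').trans hrg)
    rwa [tendsto_nhds_unique_of_isOpen hB hdiv₂ hd hB' (hDsub hdD).2.2]

end GroupoidFibration

theorem T2Space.of_subset {X : Type*} [TopologicalSpace X] {U V : Set X} [T2Space U]
    (h : V ⊆ U) : T2Space V :=
  T2Space.of_injective_continuous (f := inclusion h) (inclusion_injective h) (continuous_inclusion h)

/-! ### Left translations as homeomorphisms -/

namespace TopGroupoid

variable {X : Type*} {A : Type*} [TopologicalSpace X] [TopologicalSpace A] (G : TopGroupoid X A)

theorem continuous_tmul_left {W : Type*} [TopologicalSpace W] (k : A) {f : W → A}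
    (hf : Continuous f) (h : ∀ w, G.s k = G.r (f w)) : Continuous fun w => G.tmul k (f w) :=
  continuous_iff_continuousAt.2 fun w =>
    G.tendsto_tmul tendsto_const_nhds (hf.tendsto w) (.of_forall h) (h w)

/-- Left translation by `k` as a homeomorphism between range fibres. -/
noncomputable def leftHomeomorph (k : A) {x y : X} (hx : G.s k = x) (hy : G.r k = y) :
    Fib G.r x ≃ₜ Fib G.r y where
  toFun a := ⟨G.tmul k a.val, (G.r_tmul _ _).trans hy⟩
  invFun a := ⟨G.tmul (G.inv k) a.val, (G.r_tmul _ _).trans ((G.r_inv k).trans hx)⟩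
  left_inv a := Fib.ext (G.inv_tmul_cancel (hx.trans a.prop.symm))
  right_inv a := Fib.ext (G.tmul_inv_cancel (hy.trans a.prop.symm))
  continuous_toFun := Fib.continuous_mk (G.continuous_tmul_left k (Fib.continuous_val _ _)
    fun a => hx.trans a.prop.symm) _
  continuous_invFun := Fib.continuous_mk (G.continuous_tmul_left _ (Fib.continuous_val _ _)
    fun a => (G.s_inv k).trans (hy.trans a.prop.symm)) _

theorem coe_leftHomeomorph (k : A) : ⇑(G.leftHomeomorph k rfl rfl) = G.leftMul k :=
  funext fun a => Fib.ext (G.tmul_eq a.prop.symm)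

theorem IsHaarSystem.map_leftHomeomorph {G : TopGroupoid X A} {α : ∀ x, Measure (Fib G.r x)}
    (hα : G.IsHaarSystem α) (k : A) {x y : X} (hx : G.s k = x) (hy : G.r k = y) :
    (α x).map (G.leftHomeomorph k hx hy) = α y := by
  subst hx hy
  rw [G.coe_leftHomeomorph, hα.left_invariant]

end TopGroupoid

/-! ### The transported family along `(F¹, r)` -/

namespace GroupoidFibration

variable {L0 L1 H0 H1 : Type*} [TopologicalSpace L0] [TopologicalSpace L1]
  [TopologicalSpace H0] [TopologicalSpace H1] {L : TopGroupoid L0 L1} {H : TopGroupoid H0 H1}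
  (F : GroupoidFibration L H)

theorem isOpenQuotientMap_arrRange : IsOpenQuotientMap F.arrRange :=
  ⟨F.surjective_arrRange, F.continuous_arrRange, F.isOpenMap_arrRange⟩

/-- Left translation by `k` as a homeomorphism from a range fibre of `G` to a fibre
of `(F¹, r)`. -/
noncomputable def translateHomeomorph (k : L1) {p : F.RangePullback} (hk : F.arrRange k = p) :
    Fib F.fibre.r (L.s k) ≃ₜ Fib F.arrRange p where
  toFun g := ⟨L.tmul k g.val.1, (F.arrRange_tmul_fibre _).trans hk⟩
  invFun l := ⟨F.div k l.val, F.r_div k l.val⟩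
  left_inv g := Fib.ext (F.div_tmul g.prop.symm)
  right_inv l := Fib.ext (F.tmul_div (hk.trans l.prop.symm))
  continuous_toFun := Fib.continuous_mk (L.continuous_tmul_left k
    (continuous_subtype_val.comp (Fib.continuous_val F.fibre.r _)) fun g => g.prop.symm) _
  continuous_invFun := Fib.continuous_mk (continuous_iff_continuousAt.2 fun l =>
    F.tendsto_div tendsto_const_nhds ((Fib.continuous_val _ _).tendsto l)
      (.of_forall fun l => hk.trans l.prop.symm) (hk.trans l.prop.symm)) _

theorem coe_translateHomeomorph (k : L1) : ⇑(F.translateHomeomorph k rfl) = F.translate k :=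
  funext fun g => Fib.ext (L.tmul_eq g.prop.symm)

/-- The two parametrisations differ by left translation by `k⁻¹ k' ∈ G`, which carries `λ^{s(k')}`
to `λ^{s(k)}`. -/
theorem map_translateHomeomorph_eq {lam : ∀ x, Measure (Fib F.fibre.r x)}
    (hlam : F.fibre.IsHaarSystem lam) {k k' : L1} {p : F.RangePullback} (hk : F.arrRange k = p)
    (hk' : F.arrRange k' = p) : (lam (L.s k)).map (F.translateHomeomorph k hk) =
      (lam (L.s k')).map (F.translateHomeomorph k' hk') := by
  have hR := hk.trans hk'.symm
  have hx : F.fibre.s (F.div k k') = L.s k' := F.s_div hR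
  have hy : F.fibre.r (F.div k k') = L.s k := F.r_div k k'
  rw [← hlam.map_leftHomeomorph (F.div k k') hx hy,
    Measure.map_map (F.translateHomeomorph k hk).continuous.measurable
      (F.fibre.leftHomeomorph _ hx hy).continuous.measurable]
  congr 1
  ext g
  have e : L.s (F.div k k').1 = L.r g.val.1 := (F.s_div hR).trans g.prop.symm
  change L.tmul k (F.fibre.tmul (F.div k k') g.val).1 = L.tmul k' g.val.1
  rw [F.fibre_tmul_val e, ← L.tmul_assoc (F.r_div k k').symm e, F.tmul_div hR]

/-- The measures on the fibres of `(F¹, r)` induced by a family on the fibre groupoid. -/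
noncomputable def transported (lam : ∀ x, Measure (Fib F.fibre.r x)) (p : F.RangePullback) :
    Measure (Fib F.arrRange p) :=
  (lam (L.s (F.surjective_arrRange p).choose)).map
    (F.translateHomeomorph _ (F.surjective_arrRange p).choose_spec)

theorem transported_eq {lam : ∀ x, Measure (Fib F.fibre.r x)}
    (hlam : F.fibre.IsHaarSystem lam) {k : L1} {p : F.RangePullback} (hk : F.arrRange k = p) :
    F.transported lam p = (lam (L.s k)).map (F.translateHomeomorph k hk) :=
  F.map_translateHomeomorph_eq hlam _ _

theorem isTransported_transported {lam : ∀ x, Measure (Fib F.fibre.r x)}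
    (hlam : F.fibre.IsHaarSystem lam) : F.IsTransported lam (F.transported lam) := fun k => by
  rw [F.transported_eq hlam rfl, F.coe_translateHomeomorph]

theorem regular_transported {lam : ∀ x, Measure (Fib F.fibre.r x)}
    (hlam : F.fibre.IsHaarSystem lam) (p : F.RangePullback) : (F.transported lam p).Regular := by
  have := hlam.isContinuousFamily.regular
  exact Measure.Regular.map _

theorem integral_transported {E : Type*} [NormedAddCommGroup E] [NormedSpace ℝ E]
    {lam : ∀ x, Measure (Fib F.fibre.r x)}
    (hlam : F.fibre.IsHaarSystem lam) {k : L1} {p : F.RangePullback} (hk : F.arrRange k = p)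
    (f : L1 → E) : ∫ l, f l.val ∂(F.transported lam p) =
      ∫ g : Fib F.fibre.r (L.s k), f (L.tmul k g.val.1) ∂(lam (L.s k)) := by
  rw [F.transported_eq hlam hk, (F.translateHomeomorph k hk).measurableEmbedding.integral_map]
  rfl

theorem arrowCorrespondence [T2Space L0] [T1Space F.RangePullback] :
    FibreCorrespondence F.fibre.r L.s (fun k l => F.arrRange k = F.arrRange l) F.div
      (fun k g => L.tmul k g.1) where
  continuous_p := F.fibre.continuous_r
  continuous_q := L.continuous_s
  right _ g hg := ⟨(F.arrRange_tmul_fibre g).symm, F.div_tmul hg.symm⟩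
  left _ _ h := ⟨F.r_div _ _, F.tmul_div h⟩
  tendsto_theta k l h := F.tendsto_div ((continuous_fst.tendsto (k, l)).mono_left inf_le_left)
    ((continuous_snd.tendsto (k, l)).mono_left inf_le_left)
    (Filter.mem_inf_of_right (Filter.mem_principal_self _)) h
  tendsto_m k g h := L.tendsto_tmul ((continuous_fst.tendsto (k, g)).mono_left inf_le_left)
    (((continuous_subtype_val.comp continuous_snd).tendsto (k, g)).mono_left inf_le_left)
    (Filter.mem_inf_of_right (Filter.mem_principal.2 fun _ h => Eq.symm h)) h.symm
  isClosed k := by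
    simp_rw [eq_comm (a := F.arrRange k)]
    exact isClosed_singleton.preimage F.continuous_arrRange

/-- The inclusion of a fibre of `(F¹, r)` into a range fibre. -/
def rangeInclusion (p : F.RangePullback) (l : Fib F.arrRange p) : Fib L.r p.1.2 :=
  ⟨l.val, congrArg (fun q : F.RangePullback => q.1.2) l.prop⟩

theorem continuous_rangeInclusion (p : F.RangePullback) : Continuous (F.rangeInclusion p) :=
  Fib.continuous_mk (Fib.continuous_val _ _) _

theorem isClosedEmbedding_rangeInclusion [T1Space F.RangePullback] (p : F.RangePullback) :
    IsClosedEmbedding (F.rangeInclusion p) := by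
  refine ⟨⟨.of_comp (F.continuous_rangeInclusion p) (Fib.continuous_val L.r p.1.2)
    (Fib.isInducing F.arrRange p), fun a b h => Fib.ext (congrArg (fun l : Fib L.r p.1.2 => l.val) h)⟩, ?_⟩
  have : range (F.rangeInclusion p) = (fun l : Fib L.r p.1.2 => F.arrRange l.val) ⁻¹' {p} := by
    ext l
    exact ⟨fun ⟨a, ha⟩ => ha ▸ a.prop, fun h => ⟨⟨l.val, h⟩, rfl⟩⟩
  rw [this]
  exact isClosed_singleton.preimage (F.continuous_arrRange.comp (Fib.continuous_val L.r p.1.2))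

theorem t2Space_fib_arrRange [T2Space L0] [T1Space L1] (p : F.RangePullback) :
    T2Space (Fib F.arrRange p) := by
  have := L.t2Space_fib_r p.1.2
  exact T2Space.of_injective_continuous (f := F.rangeInclusion p)
    (fun a b h => Fib.ext (congrArg (fun l : Fib L.r p.1.2 => l.val) h)) (F.continuous_rangeInclusion p)

section Standing

variable [T2Space L0] [LocallyCompactSpace L0] [T2Space H0] [LocallyCompactSpace F.FibreArrow]
  [LocallyCompactSpace H1] {lam : ∀ x : L0, Measure (Fib F.fibre.r x)}

/-- The transported measures form a continuous family. -/
theorem isContinuousFamily_transported (hG : IsLocallyHausdorff F.FibreArrow)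
    (hH : IsLocallyHausdorff H1) (hlam : F.fibre.IsHaarSystem lam) :
    IsContinuousFamily F.arrRange (F.transported lam) := by
  have hL := F.isLocallyHausdorff_arrows hG hH
  have := hL.t1Space
  have := hG.t1Space
  have hP := F.isLocallyHausdorff_rangePullback hH
  have := hP.t1Space
  have := F.locallyCompactSpace_arrows hG
  have := F.regular_transported hlam
  have := F.fibre.t2Space_fib_r
  have := F.t2Space_fib_arrRange
  refine ⟨F.regular_transported hlam, fun f hf => ?_⟩
  refine integral_mem_quasiContinuous (fun U hU hU2 f hf => ?_) hf
  have hint : ∀ g, CcOn U g → ∀ p, Integrable (fun l => g l.val) (F.transported lam p) :=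
    fun g hg p => by
      have h := hg.comp_fib F.continuous_arrRange (y := p) hU
      exact h.1.integrable_of_hasCompactSupport h.2
  refine ⟨hint f hf, ?_⟩
  refine (hf.induction_local hU (P := fun f => CcOn U f ∧
    (fun p => ∫ l, f l.val ∂(F.transported lam p)) ∈ quasiContinuous F.RangePullback)
    ⟨CcOn.zero U, ?_⟩ ?_ ?_).2
  · convert Submodule.zero_mem _ using 1
    ext p
    simp
  · rintro f g ⟨hf, hf'⟩ ⟨hg, hg'⟩
    refine ⟨hf.add hg, ?_⟩
    convert Submodule.add_mem _ hf' hg' using 1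
    ext p
    exact integral_add (hint f hf p) (hint g hg p)
  · intro t ht
    -- The support is localised over a Hausdorff open `V`, so that the integral is a single function
    -- continuous on `V` with compact support there.
    obtain ⟨V, hV, htV, hV2⟩ := hP (F.arrRange t)
    have hO := hV.preimage F.continuous_arrRange
    refine ⟨_, hO, htV, fun g hg => ⟨hg.mono (hU.inter hO) inter_subset_left, ?_⟩⟩
    have : T2Space ↥(U ∩ F.arrRange ⁻¹' V) := T2Space.of_subset inter_subset_left
    refine CcOn.mem_quasiContinuous hV ⟨fun p hp => ContinuousAt.continuousWithinAt ?_, ?_⟩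
    · obtain ⟨k, rfl⟩ := F.surjective_arrRange p
      -- Continuity can be tested in `k` along the open quotient map `(F¹, r)`, where the integral
      -- becomes `∫ g(k γ) dλ^{s(k)}(γ)`.
      rw [← F.isOpenQuotientMap_arrRange.continuousAt_comp_iff]
      refine (F.arrowCorrespondence.continuousAt_integral hG hlam.isContinuousFamily
        (z₀ := k) (hU.inter hO) (fun l hl hkl => ?_) hg).congr
        (.of_forall fun k => (F.integral_transported hlam rfl g).symm)
      -- Having equal images is a closed relation near `(k, l)` because both images lie in the
      -- Hausdorff set `V`.
      by_contra h
      have hfr : ∃ᶠ a : L1 × L1 in 𝓝 (k, l), F.arrRange a.1 = F.arrRange a.2 := h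
      have := Filter.frequently_iff_neBot.1 hfr
      have h1 := (F.continuous_arrRange.comp continuous_fst).tendsto (k, l)
      have h2 := (F.continuous_arrRange.comp continuous_snd).tendsto (k, l)
      refine hkl (tendsto_nhds_unique_of_isOpen hV (h1.mono_left (inf_le_left (b :=
        Filter.principal {a : L1 × L1 | F.arrRange a.1 = F.arrRange a.2})))
        ((h2.mono_left inf_le_left).congr' ?_) hp hl.2)
      exact Filter.mem_inf_of_right (Filter.mem_principal.2 fun a ha => Eq.symm ha)
    · obtain ⟨-, K, hKU, hK, hgK⟩ := hg
      refine ⟨F.arrRange '' K, ?_, hK.image F.continuous_arrRange, fun p hp => ?_⟩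
      · rintro _ ⟨l, hl, rfl⟩
        exact (hKU hl).2
      · exact integral_eq_zero_of_ae (.of_forall fun l => hgK _ fun hl => hp ⟨_, hl, l.prop⟩)

end Standing

end GroupoidFibration

/-! ### The kernel from `H^{F⁰(x)}` to `L^x`, and the pullback of `μ` to `L⁰` -/

namespace GroupoidFibration

open scoped CompactlySupported

variable {L0 L1 H0 H1 : Type*} [TopologicalSpace L0] [TopologicalSpace L1]
  [TopologicalSpace H0] [TopologicalSpace H1] {L : TopGroupoid L0 L1} {H : TopGroupoid H0 H1}
  (F : GroupoidFibration L H)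

/-- The map `L^x → H^{F⁰(x)}` induced by `F¹`. -/
def fibreMap (x : L0) (l : Fib L.r x) : Fib H.r (F.obj x) :=
  ⟨F.arr l.val, (F.r_arr _).trans (congrArg F.obj l.prop)⟩

/-- The map `h ↦ (h, x)`. -/
def pullbackMk (x : L0) (h : Fib H.r (F.obj x)) : F.RangePullback := ⟨(h.val, x), h.prop⟩

theorem continuous_pullbackMk (x : L0) : Continuous (F.pullbackMk x) :=
  ((Fib.continuous_val _ _).prodMk continuous_const).subtype_mk _

theorem arrRange_eq_pullbackMk {x : L0} (l : Fib L.r x) :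
    F.arrRange l.val = F.pullbackMk x (F.fibreMap x l) :=
  Subtype.ext (Prod.ext rfl l.prop)

theorem fibreMap_eq_iff {x : L0} {k l : Fib L.r x} :
    F.fibreMap x k = F.fibreMap x l ↔ F.arrRange k.val = F.arrRange l.val := by
  rw [F.arrRange_eq_iff]
  exact ⟨fun h => ⟨congrArg Fib.val h, k.prop.trans l.prop.symm⟩, fun h => Fib.ext h.1⟩

theorem isOpenQuotientMap_fibreMap (x : L0) : IsOpenQuotientMap (F.fibreMap x) := by
  refine ⟨fun h => ?_, Fib.continuous_mk (F.continuous_arr.comp (Fib.continuous_val _ _)) _, ?_⟩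
  · obtain ⟨l, hl⟩ := F.surjective_arrRange (F.pullbackMk x h)
    exact ⟨⟨l, congrArg (fun p : F.RangePullback => p.1.2) hl⟩,
      Fib.ext (congrArg (fun p : F.RangePullback => p.1.1) hl)⟩
  · rintro _ ⟨O, hO, rfl⟩
    convert (F.isOpenMap_arrRange O hO).preimage (F.continuous_pullbackMk x) using 1
    ext h
    constructor
    · rintro ⟨l, hl, rfl⟩
      exact ⟨l.val, hl, F.arrRange_eq_pullbackMk l⟩
    · rintro ⟨l, hl, e⟩
      exact ⟨⟨l, congrArg (fun p : F.RangePullback => p.1.2) e⟩, hl,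
        Fib.ext (congrArg (fun p : F.RangePullback => p.1.1) e)⟩

theorem fibreCorrespondence [T2Space L0] [∀ y, T2Space (Fib H.r y)] (x : L0) :
    FibreCorrespondence F.fibre.r (fun k : Fib L.r x => L.s k.val)
      (fun k l => F.fibreMap x k = F.fibreMap x l) (fun k l => F.div k.val l.val)
      (fun k g => ⟨L.tmul k.val g.1, (L.r_tmul _ _).trans k.prop⟩) where
  continuous_p := F.fibre.continuous_r
  continuous_q := L.continuous_s.comp (Fib.continuous_val _ _)
  right k g hg := ⟨F.fibreMap_eq_iff.2 (F.arrRange_tmul_fibre g).symm, F.div_tmul hg.symm⟩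
  left k l h := ⟨F.r_div _ _, Fib.ext (F.tmul_div (F.fibreMap_eq_iff.1 h))⟩
  tendsto_theta k l h := F.tendsto_div
    ((((Fib.continuous_val L.r x).comp continuous_fst).tendsto (k, l)).mono_left inf_le_left)
    ((((Fib.continuous_val L.r x).comp continuous_snd).tendsto (k, l)).mono_left inf_le_left)
    (Filter.mem_inf_of_right (Filter.mem_principal.2 fun _ h => F.fibreMap_eq_iff.1 h))
    (F.fibreMap_eq_iff.1 h)
  tendsto_m k g h := by
    rw [(Fib.isInducing L.r x).tendsto_nhds_iff]
    exact L.tendsto_tmul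
      ((((Fib.continuous_val L.r x).comp continuous_fst).tendsto (k, g)).mono_left inf_le_left)
      (((continuous_subtype_val.comp continuous_snd).tendsto (k, g)).mono_left inf_le_left)
      (Filter.mem_inf_of_right (Filter.mem_principal.2 fun _ h => Eq.symm h)) h.symm
  isClosed k := isClosed_eq continuous_const (F.isOpenQuotientMap_fibreMap x).continuous

open Classical in
/-- The point `(h, x)` of `H¹ ×_{r, H⁰, F⁰} L⁰`, with a junk value when `r h ≠ F⁰ x`. -/
noncomputable def pullbackPoint (x : L0) (h : H1) : F.RangePullback :=
  if e : H.r h = F.obj x then ⟨(h, x), e⟩ else ⟨(H.unit (F.obj x), x), H.r_unit _⟩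

theorem pullbackPoint_eq {x : L0} {h : H1} (e : H.r h = F.obj x) :
    F.pullbackPoint x h = ⟨(h, x), e⟩ := dif_pos e

theorem pullbackCorrespondence [T2Space L0] :
    FibreCorrespondence H.r F.obj (fun x (t : F.RangePullback) => t.1.2 = x) (fun _ t => t.1.1)
      F.pullbackPoint where
  continuous_p := H.continuous_r
  continuous_q := F.continuous_obj
  right x h e := by simp [F.pullbackPoint_eq e]
  left x t e := by
    subst e
    exact ⟨t.2, F.pullbackPoint_eq t.2⟩
  tendsto_theta x t _ := ((continuous_fst.comp (continuous_subtype_val.comp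
    continuous_snd)).tendsto (x, t)).mono_left inf_le_left
  tendsto_m x h e := by
    rw [F.pullbackPoint_eq e, tendsto_subtype_rng]
    refine Filter.Tendsto.congr' (f₁ := fun a : L0 × H1 => (a.2, a.1)) ?_
      ((continuous_swap.tendsto (x, h)).mono_left inf_le_left)
    exact Filter.mem_inf_of_right (Filter.mem_principal.2 fun a (ha : H.r a.2 = F.obj a.1) =>
      congrArg Subtype.val (F.pullbackPoint_eq ha).symm)
  isClosed x := isClosed_singleton.preimage (continuous_snd.comp continuous_subtype_val)

/-- The transported measures as measures on `L^x`, indexed by `H^{F⁰(x)}`. -/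
noncomputable def fibreKernel (dlam : ∀ p, Measure (Fib F.arrRange p)) (x : L0)
    (h : Fib H.r (F.obj x)) : Measure (Fib L.r x) :=
  (dlam (F.pullbackMk x h)).map (F.rangeInclusion (F.pullbackMk x h))

section Integrals

variable [T1Space F.RangePullback]

theorem integral_fibreKernel {E : Type*} [NormedAddCommGroup E] [NormedSpace ℝ E]
    (dlam : ∀ p, Measure (Fib F.arrRange p)) (x : L0) (h : Fib H.r (F.obj x)) (f : Fib L.r x → E) :
    ∫ l, f l ∂(F.fibreKernel dlam x h) =
      ∫ l, f (F.rangeInclusion (F.pullbackMk x h) l) ∂(dlam (F.pullbackMk x h)) :=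
  (F.isClosedEmbedding_rangeInclusion (F.pullbackMk x h)).measurableEmbedding.integral_map _

theorem lintegral_fibreKernel (dlam : ∀ p, Measure (Fib F.arrRange p)) (x : L0)
    (h : Fib H.r (F.obj x)) (f : Fib L.r x → ℝ≥0∞) : ∫⁻ l, f l ∂(F.fibreKernel dlam x h) =
      ∫⁻ l, f (F.rangeInclusion (F.pullbackMk x h) l) ∂(dlam (F.pullbackMk x h)) :=
  (F.isClosedEmbedding_rangeInclusion (F.pullbackMk x h)).measurableEmbedding.lintegral_map _

theorem integral_fibreKernel_transported {E : Type*} [NormedAddCommGroup E] [NormedSpace ℝ E]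
    {lam : ∀ x : L0, Measure (Fib F.fibre.r x)} (hlam : F.fibre.IsHaarSystem lam) {x : L0}
    (l : Fib L.r x) {h : Fib H.r (F.obj x)} (hl : F.fibreMap x l = h) {y : L0}
    (hy : L.s l.val = y) (f : Fib L.r x → E) :
    ∫ l, f l ∂(F.fibreKernel (F.transported lam) x h) = ∫ g : Fib F.fibre.r y,
      f ⟨L.tmul l.val g.val.1, (L.r_tmul _ _).trans l.prop⟩ ∂(lam y) := by
  subst hy
  subst hl
  rw [F.integral_fibreKernel, F.transported_eq hlam (F.arrRange_eq_pullbackMk l),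
    (F.translateHomeomorph l.val _).measurableEmbedding.integral_map]
  rfl

end Integrals

section Standing

variable [T2Space L0] [LocallyCompactSpace L0] [T2Space H0] [LocallyCompactSpace F.FibreArrow]
  [LocallyCompactSpace H1] {lam : ∀ x : L0, Measure (Fib F.fibre.r x)}
  {mu : ∀ y : H0, Measure (Fib H.r y)}

/-- Continuity in `h` is tested along the open quotient map `L^x → H^{F⁰(x)}`. The image of the
support of `f` under this map contains all `h` with nonzero integral. -/
theorem isRadonKernel_fibreKernel (hG : IsLocallyHausdorff F.FibreArrow)
    (hH : IsLocallyHausdorff H1) (hlam : F.fibre.IsHaarSystem lam) (x : L0)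
    [T2Space (Fib L.r x)] [LocallyCompactSpace (Fib L.r x)] [∀ y, T2Space (Fib H.r y)] :
    IsRadonKernel (F.fibreKernel (F.transported lam) x) := by
  have := (F.isLocallyHausdorff_rangePullback hH).t1Space
  have := hG.t1Space
  have := F.regular_transported hlam
  have := F.fibre.t2Space_fib_r
  have hemb := F.isClosedEmbedding_rangeInclusion
  refine ⟨fun h => ⟨fun K hK => ?_⟩, fun h => ?_, fun f => ?_, fun f => ?_⟩
  · exact lt_of_eq_of_lt ((hemb (F.pullbackMk x h)).measurableEmbedding.map_apply _ K)
      ((hemb (F.pullbackMk x h)).isCompact_preimage hK).measure_lt_top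
  · exact Measure.InnerRegularWRT.map Measure.Regular.innerRegular
      (F.continuous_rangeInclusion _).measurable.aemeasurable
      (fun U hU => hU.preimage (F.continuous_rangeInclusion _))
      (fun K hK => hK.image (F.continuous_rangeInclusion _)) (fun U hU => hU.measurableSet)
  · refine continuous_iff_continuousAt.2 fun h => ?_
    obtain ⟨k, rfl⟩ := (F.isOpenQuotientMap_fibreMap x).surjective h
    rw [← (F.isOpenQuotientMap_fibreMap x).continuousAt_comp_iff]
    have : T2Space (univ : Set (Fib L.r x)) := inferInstance
    have hf : CcOn univ (fun l : Fib L.r x => (f l : ℂ)) :=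
      ⟨(Complex.continuous_ofReal.comp f.continuous).continuousOn, tsupport f, subset_univ _,
        f.hasCompactSupport.isCompact, fun l hl => by simp [image_eq_zero_of_notMem_tsupport hl]⟩
    have hc := (F.fibreCorrespondence x).continuousAt_integral hG hlam.isContinuousFamily
      (z₀ := k) isOpen_univ (fun l _ hkl => (isOpen_ne_fun
        ((F.isOpenQuotientMap_fibreMap x).continuous.comp continuous_fst)
        ((F.isOpenQuotientMap_fibreMap x).continuous.comp continuous_snd)).mem_nhds hkl) hf
    refine (Complex.continuous_re.continuousAt.comp hc).congr (.of_forall fun l => ?_)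
    rw [Function.comp, Function.comp, F.integral_fibreKernel_transported hlam l rfl rfl,
      integral_complex_ofReal, Complex.ofReal_re]
  · refine HasCompactSupport.intro
      (f.hasCompactSupport.isCompact.image (F.isOpenQuotientMap_fibreMap x).continuous)
      fun h hh => ?_
    rw [F.integral_fibreKernel]
    refine integral_eq_zero_of_ae (.of_forall fun l => ?_)
    refine image_eq_zero_of_notMem_tsupport fun hl => hh ⟨_, hl, Fib.ext ?_⟩
    exact congrArg (fun p : F.RangePullback => p.1.1) l.prop

/-- This says that the pullback of `μ` along `F⁰` is again continuous. As `L⁰` is Hausdorff, it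
suffices to treat generators and obtain a continuous function, supported in the projection of a
compact set. -/
theorem integral_pullback_mem_quasiContinuous [LocallyCompactSpace H0]
    (hH : IsLocallyHausdorff H1) (hmu : H.IsHaarSystem mu) [∀ y, T2Space (Fib H.r y)]
    {φ : F.RangePullback → ℂ} (hφ : φ ∈ quasiContinuous F.RangePullback) :
    (fun x => ∫ h, φ (F.pullbackMk x h) ∂(mu (F.obj x))) ∈ quasiContinuous L0 := by
  have := F.locallyCompactSpace_rangePullback
  have := hmu.isContinuousFamily.regular
  have hpb := F.pullbackCorrespondence
  have hm : ∀ (φ : F.RangePullback → ℂ) x, (fun h : Fib H.r (F.obj x) => φ (F.pullbackMk x h)) =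
      fun h => φ (F.pullbackPoint x h.val) := fun φ x => by
    ext h
    rw [F.pullbackPoint_eq h.prop]
    rfl
  refine integral_mem_quasiContinuous (fun V hV hV2 φ hφ => ?_) hφ
  refine ⟨fun x => ?_, ?_⟩
  · have h := hpb.continuous_hasCompactSupport x hV hφ
    rw [hm]
    exact h.1.integrable_of_hasCompactSupport h.2
  · have : T2Space (univ : Set L0) := inferInstance
    refine CcOn.mem_quasiContinuous isOpen_univ ⟨?_, ?_⟩
    · refine (continuous_iff_continuousAt.2 fun x => ?_).continuousOn
      simp_rw [hm]
      refine hpb.continuousAt_integral hH hmu.isContinuousFamily hV (fun t _ ht => ?_) hφ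
      exact (isOpen_ne_fun (continuous_snd.comp (continuous_subtype_val.comp continuous_snd))
        continuous_fst).mem_nhds ht
    · obtain ⟨-, K, hKV, hK, hφK⟩ := hφ
      refine ⟨_, subset_univ _,
        hK.image (continuous_snd.comp continuous_subtype_val), fun x hx => ?_⟩
      exact integral_eq_zero_of_ae (.of_forall fun h => hφK _ fun hh => hx ⟨_, hh, rfl⟩)

end Standing

end GroupoidFibration

/-! ### The Haar system on the total groupoid -/

namespace GroupoidFibration

open scoped CompactlySupported

variable {L0 L1 H0 H1 : Type*} [TopologicalSpace L0] [TopologicalSpace L1]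
  [TopologicalSpace H0] [TopologicalSpace H1] {L : TopGroupoid L0 L1} {H : TopGroupoid H0 H1}
  (F : GroupoidFibration L H) [T2Space L0] {lam : ∀ x : L0, Measure (Fib F.fibre.r x)}
  {mu : ∀ y : H0, Measure (Fib H.r y)} {nu : ∀ x : L0, Measure (Fib L.r x)}

/-- The measures `ν^x` are composites of `μ^{F⁰(x)}` with the transported measures. -/
structure IsComposite (lam : ∀ x : L0, Measure (Fib F.fibre.r x))
    (mu : ∀ y : H0, Measure (Fib H.r y)) (nu : ∀ x : L0, Measure (Fib L.r x)) : Prop where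
  regular : ∀ x, (nu x).Regular
  lintegral_eq : ∀ (x : L0) (f : Fib L.r x → ℝ≥0∞), Measurable f →
    (∃ K, IsCompact K ∧ ∀ l, l ∉ K → f l = 0) → ∫⁻ l, f l ∂(nu x) =
      ∫⁻ h, ∫⁻ l, f l ∂(F.fibreKernel (F.transported lam) x h) ∂(mu (F.obj x))
  integral_eq : ∀ (x : L0) (f : Fib L.r x → ℂ), Integrable f (nu x) →
    (∃ K, IsCompact K ∧ ∀ l, l ∉ K → f l = 0) → ∫ l, f l ∂(nu x) =
      ∫ h, ∫ l, f l ∂(F.fibreKernel (F.transported lam) x h) ∂(mu (F.obj x))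
  integral_eq_real : ∀ (x : L0) (f : C_c(Fib L.r x, ℝ)), ∫ l, f l ∂(nu x) =
      ∫ h, ∫ l, f l ∂(F.fibreKernel (F.transported lam) x h) ∂(mu (F.obj x))

theorem exists_isComposite [LocallyCompactSpace L0] [T2Space H0] [LocallyCompactSpace H0]
    [LocallyCompactSpace F.FibreArrow] [LocallyCompactSpace H1]
    (hG : IsLocallyHausdorff F.FibreArrow) (hH : IsLocallyHausdorff H1)
    (hlam : F.fibre.IsHaarSystem lam) (hmu : H.IsHaarSystem mu)
    [∀ x, T2Space (Fib L.r x)] [∀ x, LocallyCompactSpace (Fib L.r x)]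
    [∀ y, T2Space (Fib H.r y)] [∀ y, LocallyCompactSpace (Fib H.r y)] :
    ∃ nu, F.IsComposite lam mu nu := by
  have := hmu.isContinuousFamily.regular
  have hκ := F.isRadonKernel_fibreKernel hG hH hlam
  refine ⟨fun x => (hκ x).composite (mu (F.obj x)), fun x => inferInstance, ?_, ?_, ?_⟩
  · rintro x f hf ⟨K, hK, hfK⟩
    exact (hκ x).lintegral_composite _ hf hK hfK
  · rintro x f hf ⟨K, hK, hfK⟩
    exact (hκ x).integral_composite _ hf hK hfK
  · exact fun x f => (hκ x).integral_composite_compactlySupported _ f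

namespace IsComposite

variable {F} [T1Space F.RangePullback] [T1Space L1]

theorem isIterated (hnu : F.IsComposite lam mu nu) : F.IsIterated mu (F.transported lam) nu := by
  borelize L1
  have hK : ∀ x {K : Set L1}, IsCompact K → IsCompact ((Fib.val : Fib L.r x → L1) ⁻¹' K) :=
    fun x K hK => (Fib.isClosedEmbedding L.continuous_r x).isCompact_preimage hK
  constructor
  · rintro x f hf ⟨K, hKc, hfK⟩
    rw [hnu.lintegral_eq x (fun l => f l.val) (hf.comp (Fib.continuous_val L.r x).measurable)
      ⟨_, hK x hKc, fun l hl => hfK _ hl⟩]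
    simp_rw [F.lintegral_fibreKernel]
    rfl
  · rintro x f hf ⟨K, hKc, hfK⟩ hi
    rw [hnu.integral_eq x _ hi ⟨_, hK x hKc, fun l hl => hfK _ hl⟩]
    simp_rw [F.integral_fibreKernel]
    rfl

/-- Integration against `ν` factors through integration along `(F¹, r)`, followed by the pullback of
`μ`; each step preserves quasi-continuity. -/
theorem isContinuousFamily (hnu : F.IsComposite lam mu nu) [LocallyCompactSpace L0] [T2Space H0]
    [LocallyCompactSpace H0] [LocallyCompactSpace F.FibreArrow] [LocallyCompactSpace H1]
    (hG : IsLocallyHausdorff F.FibreArrow) (hH : IsLocallyHausdorff H1)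
    (hlam : F.fibre.IsHaarSystem lam) (hmu : H.IsHaarSystem mu)
    [∀ x, T2Space (Fib L.r x)] [∀ y, T2Space (Fib H.r y)] :
    IsContinuousFamily L.r nu := by
  have := hnu.regular
  refine ⟨hnu.regular, fun f hf => ?_⟩
  refine integral_mem_quasiContinuous (fun U hU hU2 f hf => ?_) hf
  have hfc := fun x => hf.comp_fib L.continuous_r (y := x) hU
  have hi : ∀ x, Integrable (fun l => f l.val) (nu x) := fun x =>
    (hfc x).1.integrable_of_hasCompactSupport (hfc x).2
  refine ⟨hi, ?_⟩
  convert F.integral_pullback_mem_quasiContinuous hH hmu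
    ((F.isContinuousFamily_transported hG hH hlam).continuous f (hf.mem_quasiContinuous hU))
    using 1
  ext x
  rw [hnu.integral_eq x _ (hi x)
    ⟨_, (hfc x).2.isCompact, fun l hl => image_eq_zero_of_notMem_tsupport (f := fun l : Fib L.r x => f l.val) hl⟩]
  simp_rw [F.integral_fibreKernel]
  rfl

/-- A cutoff at `k ∈ O` supported in `O` has positive inner integral at `h = F¹(k)` by full support
of `λ`. Since the inner integral is continuous in `h`, full support of `μ` makes the outer one
positive. -/
theorem isOpenPosMeasure (hnu : F.IsComposite lam mu nu) [LocallyCompactSpace L0] [T2Space H0]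
    [LocallyCompactSpace F.FibreArrow] [LocallyCompactSpace H1]
    (hG : IsLocallyHausdorff F.FibreArrow) (hH : IsLocallyHausdorff H1)
    (hlam : F.fibre.IsHaarSystem lam) (hmu : H.IsHaarSystem mu)
    [∀ x, T2Space (Fib L.r x)] [∀ x, LocallyCompactSpace (Fib L.r x)]
    [∀ y, T2Space (Fib H.r y)] (x : L0) : (nu x).IsOpenPosMeasure := by
  have hκ := F.isRadonKernel_fibreKernel hG hH hlam x
  have := hmu.isContinuousFamily.regular
  have := hlam.isContinuousFamily.regular
  have := hmu.full_support
  have := hlam.full_support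
  have := hG.t1Space
  have := F.fibre.t2Space_fib_r
  refine ⟨fun O hO ⟨k, hk⟩ h0 => ?_⟩
  obtain ⟨f, hf⟩ := IsRadonKernel.exists_cutoff isCompact_singleton hO (singleton_subset_iff.2 hk)
  have hfk := hf k rfl
  have h1 : ∫ l, f.1 l ∂(nu x) = 0 := by
    rw [← setIntegral_eq_integral_of_forall_compl_eq_zero f.2.2.2, setIntegral_measure_zero _ h0]
  have h2 : 0 < ∫ l, f.1 l ∂(F.fibreKernel (F.transported lam) x (F.fibreMap x k)) := by
    rw [F.integral_fibreKernel_transported hlam k rfl rfl]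
    have hc := F.fibreCorrespondence x
    refine Continuous.integral_pos_of_hasCompactSupport_nonneg_nonzero
      (x := ⟨F.fibre.unit (L.s k.val), F.fibre.r_unit _⟩) (f.1.continuous.comp (hc.continuous_m k))
      (HasCompactSupport.intro (hc.isCompact_preimage k f.1.hasCompactSupport.isCompact)
        fun g hg => image_eq_zero_of_notMem_tsupport hg) (fun g => f.2.1 _) ?_
    have e : (⟨L.tmul k.val (F.fibre.unit (L.s k.val)).1, (L.r_tmul _ _).trans k.prop⟩ :
        Fib L.r x) = k := Fib.ext (L.tmul_unit rfl)
    rw [e, hfk]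
    exact one_ne_zero
  have h3 := (hκ.continuous f.1).integral_pos_of_hasCompactSupport_nonneg_nonzero
    (μ := mu (F.obj x)) (hκ.support f.1) (fun h => integral_nonneg f.2.1) h2.ne'
  rw [← hnu.integral_eq_real, h1] at h3
  exact h3.false

/-- Invariance of `μ` under `F¹(k)` moves the outer integral; the inner integrals then agree because
`k (l g) = (k l) g`. -/
theorem left_invariant (hnu : F.IsComposite lam mu nu)
    (hlam : F.fibre.IsHaarSystem lam) (hmu : H.IsHaarSystem mu)
    [∀ x, T2Space (Fib L.r x)] [∀ x, LocallyCompactSpace (Fib L.r x)] (k : L1) :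
    (nu (L.s k)).map (L.leftMul k) = nu (L.r k) := by
  have := hnu.regular
  rw [← L.coe_leftHomeomorph]
  set e := L.leftHomeomorph k rfl rfl with he
  have : ((nu (L.s k)).map e).Regular := Measure.Regular.map e
  refine Measure.ext_of_integral_eq_on_compactlySupported fun f => ?_
  rw [e.measurableEmbedding.integral_map, hnu.integral_eq_real,
    ← hmu.map_leftHomeomorph (F.arr k) (F.s_arr k) (F.r_arr k),
    (H.leftHomeomorph _ _ _).measurableEmbedding.integral_map]
  refine (hnu.integral_eq_real _ ⟨⟨_, f.continuous.comp e.continuous⟩,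
    f.hasCompactSupport.comp_homeomorph e⟩).trans ?_
  refine integral_congr_ae (.of_forall fun h => ?_)
  obtain ⟨l, rfl⟩ := (F.isOpenQuotientMap_fibreMap (L.s k)).surjective h
  have hkl : L.s k = L.r l.val := l.prop.symm
  have h1 : F.fibreMap (L.r k) (e l) =
      H.leftHomeomorph (F.arr k) (F.s_arr k) (F.r_arr k) (F.fibreMap (L.s k) l) :=
    Fib.ext (F.arr_tmul hkl)
  dsimp only
  rw [F.integral_fibreKernel_transported hlam l rfl rfl,
    F.integral_fibreKernel_transported hlam (e l) h1 (L.s_tmul hkl)]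
  refine integral_congr_ae (.of_forall fun g => congrArg f (Fib.ext ?_))
  exact (L.tmul_assoc hkl g.prop.symm).symm

end IsComposite

/-- A Haar system satisfying the iterated integration formula is unique. -/
theorem IsIterated.unique {F : GroupoidFibration L H} [T1Space L1] [∀ x, T2Space (Fib L.r x)]
    [∀ x, LocallyCompactSpace (Fib L.r x)] {dlam : ∀ p, Measure (Fib F.arrRange p)}
    {nu' : ∀ x : L0, Measure (Fib L.r x)} (h : F.IsIterated mu dlam nu)
    (h' : F.IsIterated mu dlam nu') (hr : ∀ x, (nu x).Regular) (hr' : ∀ x, (nu' x).Regular) :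
    nu = nu' := by
  borelize L1
  funext x
  refine Measure.ext_of_integral_eq_on_compactlySupported fun f => ?_
  have hemb := Fib.isClosedEmbedding L.continuous_r x
  -- Extension by zero off the closed fibre is usually discontinuous, but it is Borel with
  -- quasi-compact support, which is all the iterated formula asks for.
  let g : L1 → ℂ := Function.extend Fib.val (fun l : Fib L.r x => (f l : ℂ)) 0
  have hg : ∀ l : Fib L.r x, g l.val = f l := fun l => hemb.injective.extend_apply _ _ _
  have hgm : Measurable g := hemb.measurableEmbedding.measurable_extend
    (Complex.continuous_ofReal.comp f.continuous).measurable measurable_const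
  have hgK : ∃ K : Set L1, IsCompact K ∧ ∀ l, l ∉ K → g l = 0 := by
    refine ⟨_, f.hasCompactSupport.isCompact.image hemb.continuous, fun l hl => ?_⟩
    by_cases hx : ∃ a : Fib L.r x, a.val = l
    · obtain ⟨a, rfl⟩ := hx
      rw [hg, image_eq_zero_of_notMem_tsupport fun ha => hl ⟨a, ha, rfl⟩, Complex.ofReal_zero]
    · exact Function.extend_apply' _ _ _ hx
  have h1 := h.integral_eq x g hgm hgK (by simp only [hg]; exact f.integrable.ofReal)
  have h2 := h'.integral_eq x g hgm hgK (by simp only [hg]; exact f.integrable.ofReal)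
  rw [← h2] at h1
  simp only [hg, integral_complex_ofReal] at h1
  exact_mod_cast h1

end GroupoidFibration

theorem mainTheorem2 {L0 L1 H0 H1 : Type*}
    [TopologicalSpace L0] [TopologicalSpace L1] [TopologicalSpace H0] [TopologicalSpace H1]
    (L : TopGroupoid L0 L1) (H : TopGroupoid H0 H1) (F : GroupoidFibration L H)
    [T2Space L0] [LocallyCompactSpace L0] [T2Space H0] [LocallyCompactSpace H0]
    (hG : IsLocallyHausdorff F.FibreArrow) [LocallyCompactSpace F.FibreArrow]
    (hH : IsLocallyHausdorff H1) [LocallyCompactSpace H1]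
    (lam : ∀ x : L0, Measure (Fib F.fibre.r x)) (hlam : F.fibre.IsHaarSystem lam)
    (mu : ∀ y : H0, Measure (Fib H.r y)) (hmu : H.IsHaarSystem mu) :
    (IsLocallyHausdorff L1 ∧ LocallyCompactSpace L1) ∧
    ∃ dlam : ∀ p : F.RangePullback, Measure (Fib F.arrRange p),
      F.IsTransported lam dlam ∧ IsContinuousFamily F.arrRange dlam ∧
      ∃! nu : ∀ x : L0, Measure (Fib L.r x), L.IsHaarSystem nu ∧ F.IsIterated mu dlam nu := by
  have hL := F.isLocallyHausdorff_arrows hG hH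
  have hLc := F.locallyCompactSpace_arrows hG
  have := hL.t1Space
  have := hH.t1Space
  have := (F.isLocallyHausdorff_rangePullback hH).t1Space
  have := L.t2Space_fib_r
  have := H.t2Space_fib_r
  have := fun x => (Fib.isClosedEmbedding L.continuous_r x).locallyCompactSpace
  have := fun y => (Fib.isClosedEmbedding H.continuous_r y).locallyCompactSpace
  refine ⟨⟨hL, hLc⟩, F.transported lam, F.isTransported_transported hlam,
    F.isContinuousFamily_transported hG hH hlam, ?_⟩
  obtain ⟨nu, hnu⟩ := F.exists_isComposite hG hH hlam hmu
  refine ⟨nu, ⟨⟨hnu.isContinuousFamily hG hH hlam hmu, hnu.isOpenPosMeasure hG hH hlam hmu,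
    hnu.left_invariant hlam hmu⟩, hnu.isIterated⟩, fun nu' h => ?_⟩
  exact (h.2.unique hnu.isIterated h.1.isContinuousFamily.regular hnu.regular)
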